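/- Let $n\ge 1$, $0<\beta<1$ and $0\le\alpha<n$ with $\alpha+\beta<n$, let $1<p,q<\infty$ with $\frac1q=\frac1p-\frac{\alpha+\beta}{n}$, let $-\frac np\le\lambda<0$ with $\alpha+\beta+\lambda<0$, and set $\nu=\alpha+\beta+\lambda$. Let $\Omega:\mathbb R^n\to\mathbb R$ be homogeneous of degree $0$ (that is, $\Omega(tx)=\Omega(x)$ for $t>0$, $x\neq0$), with $\Omega|_{\mathbb S^{n-1}}\in L^\infty(\mathbb S^{n-1})$ not almost everywhere zero and, if $\alpha=0$, with $\int_{\mathbb S^{n-1}}\Omega\,d\sigma=0$. Assume that there are a nonempty open set $E\subset\mathbb S^{n-1}$ and constants $c<C$, with $0<c$ or $C<0$, such that $c\le\Omega(x')\le C$ for almost every $x'\in E$; or assume instead that $\Omega$ is continuous on $\mathbb S^{n-1}$. Let $b\in L^1_{\rm loc}(\mathbb R^n)$ be real-valued. For $\varepsilon>0$ let $$T_{\alpha,\varepsilon}f(x)=\int_{|x-y|>\varepsilon}\frac{\Omega(x-y)}{|x-y|^{n-\alpha}}f(y)\,dy,\qquad [b,T_\alpha]f(x)=\lim_{\varepsilon\to0^+}\bigl(b(x)T_{\alpha,\varepsilon}f(x)-T_{\alpha,\varepsilon}(bf)(x)\bigr).$$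 For $1<s<\infty$ and $-n/s\le\kappa<0$ let $M^{s,\kappa}(\mathbb R^n)$ be the space of measurable functions $f$ with $$\|f\|_{M^{s,\kappa}}=\sup_Q|Q|^{-\kappa/n}\Bigl(\frac1{|Q|}\int_Q|f|^s\Bigr)^{1/s}<\infty,$$ the supremum being over all cubes $Q$ with sides parallel to the axes. We say that $[b,T_\alpha]$ is bounded from $X$ to $Y$ if there is a constant $A<\infty$ such that for every $f\in X$ and almost every $x$ the integrals $T_{\alpha,\varepsilon}f(x)$ and $T_{\alpha,\varepsilon}(bf)(x)$ converge absolutely for all $\varepsilon>0$, the limit $[b,T_\alpha]f(x)$ exists, and $\|[b,T_\alpha]f\|_Y\le A\|f\|_X$. Then the following three statements are equivalent: 1. $b\in\mathrm{Lip}_\beta(\mathbb R^n)$, i.e. $b$ coincides almost everywhere with a function $g$ such that $\sup_{x\ne y}|g(x)-g(y)|/|x-y|^\beta<\infty$; 2. $[b,T_\alpha]$ is bounded from $L^p(\mathbb R^n)$ to $L^q(\mathbb R^n)$; 3. $[b,T_\alpha]$ is bounded from $M^{p,\lambda}(\mathbb R^n)$ to $M^{q,\nu}(\mathbb R^n)$.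 -/

import Mathlib

open MeasureTheory Filter Topology
open scoped ENNReal NNReal

noncomputable section

/-- Euclidean space `ℝⁿ` with the Euclidean norm. -/
abbrev RSpace (n : ℕ) : Type := EuclideanSpace ℝ (Fin n)

/-- The unit sphere `S^{n-1}` of `ℝⁿ`. -/
abbrev USphere (n : ℕ) : Type := Metric.sphere (0 : RSpace n) 1

/-- The surface measure `σ` on `S^{n-1}` induced by Lebesgue measure. -/
def surfaceMeasure (n : ℕ) : Measure (USphere n) :=
  (volume : Measure (RSpace n)).toSphere

/-- `Ω` is (positively) homogeneous of degree zero. -/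
def HomogeneousDegZero {n : ℕ} (Ω : RSpace n → ℝ) : Prop :=
  ∀ (t : ℝ) (x : RSpace n), 0 < t → x ≠ 0 → Ω (t • x) = Ω x

/-- The restriction of `Ω` to the unit sphere. -/
def onSphere {n : ℕ} (Ω : RSpace n → ℝ) : USphere n → ℝ := fun u => Ω (u : RSpace n)

/-- `Ω` is bounded above and below, with one sign, (almost everywhere) on some nonempty open subset
of the sphere. -/
def LocallyOneSigned {n : ℕ} (Ω : RSpace n → ℝ) : Prop :=
  ∃ U : Set (USphere n), IsOpen U ∧ U.Nonempty ∧ ∃ c C : ℝ, c < C ∧ (0 < c ∨ C < 0) ∧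
    ∀ᵐ u ∂(surfaceMeasure n), u ∈ U → c ≤ onSphere Ω u ∧ onSphere Ω u ≤ C

/-- The function `y ↦ Ω(x - y) / |x - y|^{n - α} * f y`. -/
def roughIntegrand {n : ℕ} (α : ℝ) (Ω f : RSpace n → ℝ) (x y : RSpace n) : ℝ :=
  Ω (x - y) / ‖x - y‖ ^ ((n : ℝ) - α) * f y

/-- The truncated operator
`T_{α,ε} f(x) = ∫_{|x-y| > ε} Ω(x - y) / |x - y|^{n - α} f(y) dy`. -/
def truncOp {n : ℕ} (α : ℝ) (Ω : RSpace n → ℝ) (ε : ℝ) (f : RSpace n → ℝ) (x : RSpace n) : ℝ :=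
  ∫ y in {y : RSpace n | ε < ‖x - y‖}, roughIntegrand α Ω f x y

/-- The integral defining `T_{α,ε} f(x)` converges absolutely for every `ε > 0`. -/
def TruncDefinedAt {n : ℕ} (α : ℝ) (Ω f : RSpace n → ℝ) (x : RSpace n) : Prop :=
  ∀ ε : ℝ, 0 < ε → IntegrableOn (roughIntegrand α Ω f x) {y : RSpace n | ε < ‖x - y‖}

/-- `g` is the commutator `[b, T_α] f`.  The integral defining `T_α` is a principal value (needed
when `α = 0`; for `α > 0` and an absolutely convergent integral this is the ordinary integral), so
for almost every `x` the truncated integrals of `f` and of `b f` converge absolutely and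
`g(x) = lim_{ε → 0+} (b(x) T_{α,ε} f(x) - T_{α,ε}(b f)(x))`. -/
def IsCommutator {n : ℕ} (α : ℝ) (Ω b f g : RSpace n → ℝ) : Prop :=
  ∀ᵐ x : RSpace n, TruncDefinedAt α Ω f x ∧ TruncDefinedAt α Ω (fun y => b y * f y) x ∧
    Tendsto (fun ε : ℝ => b x * truncOp α Ω ε f x - truncOp α Ω ε (fun y => b y * f y) x)
      (𝓝[>] (0 : ℝ)) (𝓝 (g x))

/-- `[b, T_α]` is a bounded operator from `X` to `Y`, the spaces of (a.e. strongly) measurable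
functions of finite norm `normX`, `normY`: it is defined on all of `X`, takes values in `Y`, and
`‖[b, T_α] f‖_Y ≤ C ‖f‖_X` with `C` independent of `f`. -/
def CommutatorBounded {n : ℕ} (α : ℝ) (Ω b : RSpace n → ℝ)
    (normX normY : (RSpace n → ℝ) → ℝ≥0∞) : Prop :=
  ∃ C : ℝ≥0, ∀ f : RSpace n → ℝ, AEStronglyMeasurable f → normX f < ∞ →
    ∃ g : RSpace n → ℝ, IsCommutator α Ω b f g ∧ AEStronglyMeasurable g ∧
      normY g ≤ C * normX f

/-- The `L^p(ℝⁿ)` norm, `0 < p < ∞`. -/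
def lebesgueNorm {n : ℕ} (p : ℝ) (f : RSpace n → ℝ) : ℝ≥0∞ :=
  eLpNorm f (ENNReal.ofReal p) volume

/-- The closed cube with sides parallel to the axes, lower corner `a` and side length `r`. -/
def axisCube {n : ℕ} (a : RSpace n) (r : ℝ) : Set (RSpace n) :=
  {x | ∀ i, a i ≤ x i ∧ x i ≤ a i + r}

/-- The Morrey norm
`‖f‖_{M^{p,lam}} = sup_Q |Q|^{-lam/n} (|Q|⁻¹ ∫_Q |f|^p)^{1/p}`, the supremum over all cubes. -/
def morreyNorm {n : ℕ} (p lam : ℝ) (f : RSpace n → ℝ) : ℝ≥0∞ :=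
  ⨆ (a : RSpace n) (r : ℝ) (_ : 0 < r),
    (volume (axisCube a r)) ^ (-(lam / n)) *
      ((volume (axisCube a r))⁻¹ * ∫⁻ y in axisCube a r, ‖f y‖ₑ ^ p) ^ (1 / p)

/-- `b ∈ Lip_β(ℝⁿ)`: `b` agrees almost everywhere with a function `g` satisfying
`|g(x) - g(y)| ≤ C |x - y|^β` for all `x, y`. -/
def MemLip {n : ℕ} (β : ℝ) (b : RSpace n → ℝ) : Prop :=
  ∃ g : RSpace n → ℝ, b =ᵐ[volume] g ∧ ∃ C : ℝ, ∀ x y, |g x - g y| ≤ C * ‖x - y‖ ^ β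

end

/-! The commutator is formally the integral operator with kernel (b(x) - b(y)) Ω(x - y) |x - y|^(α -
n). If b is β-Hölder, this kernel is O(|x - y|^(γ - n)) with γ = α + β > 0. The integral then
converges absolutely for almost every x, is the limit of the truncations, and is dominated by the
Riesz potential of |f|; no cancellation of Ω is used, even for α = 0. Hedberg's inequality
(`exists_rieszPotential_le_dyadicMax`) and the maximal theorem bound the potential on Lebesgue
spaces; splitting f into a part near a cube and a tail gives the Morrey bound
(`exists_emorreyNorm_rieszPotential_le`).

Conversely, Ω has one sign and is bounded away from zero on a cone about some direction u₀. A ball B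
of radius r can be moved by a multiple of -r u₀ to a ball P such that x - y lies in the cone for all
x in B and y in P. Let m be a median of b on P and test on the indicator of {b ≤ m} ∩ P. At points x
of B with b(x) > m nothing cancels, so the commutator is at least a constant times r^α (b(x) - m) in
modulus. Boundedness therefore controls the integral of (b - m)₊ over B by r^(n + β), and the other
half of P controls (b - m)₋ (`exists_setLIntegral_oscillation_le`). This is Campanato's condition,
which forces Hölder continuity (`memLip_of_campanato`).

Since M^{p,-n/p} is L^p with the same norm and -n/p + γ = -n/q, the Lebesgue statement is the case λ
= -n/p of the Morrey one, and a single pair of implications serves both. -/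

/-! ### Dyadic sums in `ℝ≥0∞` -/

theorem two_rpow_add (a b : ℝ) : (2 : ℝ≥0∞) ^ (a + b) = 2 ^ a * 2 ^ b :=
  ENNReal.rpow_add _ _ (by norm_num) (by norm_num)

theorem two_rpow_ne_top (a : ℝ) : (2 : ℝ≥0∞) ^ a ≠ ∞ :=
  ENNReal.rpow_ne_top_of_ne_zero (by norm_num) (by norm_num)

theorem exists_geometric_sum_le {a : ℝ} (ha : 0 < a) :
    ∃ C : ℝ≥0∞, C ≠ ∞ ∧ ∀ K : ℤ,
      ∑' k : ℤ, (if k ≤ K then (2 : ℝ≥0∞) ^ (k * a) else 0) ≤ C * 2 ^ (K * a) := by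
  have h1 : (2 : ℝ≥0∞) ^ (-a) < 1 := ENNReal.rpow_lt_one_of_one_lt_of_neg (by norm_num) (by linarith)
  refine ⟨(1 - (2 : ℝ≥0∞) ^ (-a))⁻¹, ?_, fun K => ?_⟩
  · simpa [tsub_eq_zero_iff_le] using h1
  -- The reflection k ↦ K - k turns the sum into 2^(Ka) times a one-sided geometric series of ratio
  -- 2^(-a).
  rw [← (Equiv.subLeft K).tsum_eq]
  have h2 : ∀ k : ℤ, (if Equiv.subLeft K k ≤ K then
      (2 : ℝ≥0∞) ^ (((Equiv.subLeft K k : ℤ) : ℝ) * a) else 0) =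
      (if 0 ≤ k then ((2 : ℝ≥0∞) ^ (-a)) ^ k.toNat else 0) * 2 ^ (K * a) := by
    intro k
    simp only [Equiv.subLeft_apply]
    by_cases hk : 0 ≤ k
    · rw [if_pos (by omega), if_pos hk, ← ENNReal.rpow_natCast, ← ENNReal.rpow_mul, ← two_rpow_add]
      congr 1
      have : ((k.toNat : ℕ) : ℝ) = (k : ℝ) := by exact_mod_cast Int.toNat_of_nonneg hk
      rw [this]; push_cast; ring
    · rw [if_neg (by omega), if_neg hk, zero_mul]
  simp_rw [h2]
  rw [ENNReal.tsum_mul_right, ← ENNReal.tsum_geometric]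
  gcongr
  rw [← Function.Injective.tsum_eq (Nat.cast_injective (R := ℤ))]
  · simp
  · intro k hk
    by_cases h : 0 ≤ k
    · exact ⟨k.toNat, Int.toNat_of_nonneg h⟩
    · simp [h] at hk

theorem exists_geometric_sum_ge {a : ℝ} (ha : a < 0) :
    ∃ C : ℝ≥0∞, C ≠ ∞ ∧ ∀ K : ℤ,
      ∑' k : ℤ, (if K ≤ k then (2 : ℝ≥0∞) ^ (k * a) else 0) ≤ C * 2 ^ (K * a) := by
  obtain ⟨C, hC, h⟩ := exists_geometric_sum_le (a := -a) (by linarith)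
  refine ⟨C, hC, fun K => ?_⟩
  have := h (-K)
  rw [← (Equiv.neg ℤ).tsum_eq] at this
  simpa using this

theorem exists_two_rpow_lt_le {s : ℝ≥0∞} (h0 : s ≠ 0) (ht : s ≠ ∞) :
    ∃ k : ℤ, (2 : ℝ≥0∞) ^ (k : ℝ) < s ∧ s ≤ 2 ^ ((k : ℝ) + 1) := by
  obtain ⟨k, hk⟩ := ENNReal.exists_mem_Ioc_zpow h0 ht (y := 2) (by norm_num) (by norm_num)
  refine ⟨k, ?_, ?_⟩
  · rw [ENNReal.rpow_intCast]; exact hk.1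
  · have : ((k : ℝ) + 1) = ((k + 1 : ℤ) : ℝ) := by push_cast; ring
    rw [this, ENNReal.rpow_intCast]; exact hk.2

theorem two_rpow_le_two_rpow {a b : ℝ} (h : a ≤ b) : (2 : ℝ≥0∞) ^ a ≤ 2 ^ b :=
  ENNReal.rpow_le_rpow_of_exponent_le (by norm_num) h

theorem two_rpow_lt_iff {a b : ℝ} : (2 : ℝ≥0∞) ^ a < 2 ^ b ↔ a < b := by
  constructor
  · intro h
    by_contra! h'
    exact absurd (two_rpow_le_two_rpow h') (not_le.2 h)
  · exact fun h => ENNReal.rpow_lt_rpow_of_exponent_lt (by norm_num) (by norm_num) h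

/-- A dyadic substitute for the layer cake formula, upper bound. -/
theorem rpow_le_tsum_dyadic {p : ℝ} (hp : 0 < p) (s : ℝ≥0∞) :
    s ^ p ≤ ∑' k : ℤ, if (2 : ℝ≥0∞) ^ (k : ℝ) < s then (2 : ℝ≥0∞) ^ (((k : ℝ) + 1) * p) else 0 := by
  rcases eq_or_ne s 0 with rfl | h0
  · simp [hp]
  rcases eq_or_ne s ∞ with rfl | ht
  · have hlt : ∀ k : ℤ, (2 : ℝ≥0∞) ^ (k : ℝ) < ∞ := fun k => (two_rpow_ne_top _).lt_top
    simp only [hlt, if_true]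
    have : ∀ m : ℕ, ((m : ℕ) : ℝ≥0∞) ≤ ∑' k : ℤ, (2 : ℝ≥0∞) ^ (((k : ℝ) + 1) * p) := by
      intro m
      have h1 : ∀ k ∈ (Finset.range m).map Nat.castEmbedding, (1 : ℝ≥0∞) ≤
          (2 : ℝ≥0∞) ^ ((((k : ℤ) : ℝ) + 1) * p) := by
        intro k hk
        have hk0 : 0 ≤ k := by
          simp only [Finset.mem_map] at hk
          obtain ⟨a, _, rfl⟩ := hk
          simp
        refine ENNReal.one_le_rpow (by norm_num) ?_
        have : (0 : ℝ) ≤ k := by exact_mod_cast hk0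
        positivity
      refine le_trans ?_ (ENNReal.sum_le_tsum ((Finset.range m).map Nat.castEmbedding))
      refine le_trans ?_ (Finset.sum_le_sum h1)
      simp
    have htop : ∑' k : ℤ, (2 : ℝ≥0∞) ^ (((k : ℝ) + 1) * p) = ∞ := ENNReal.eq_top_of_forall_nnreal_le fun r => by
      obtain ⟨m, hm⟩ := exists_nat_ge r
      exact le_trans (by exact_mod_cast hm) (this m)
    rw [htop]; exact le_top
  · obtain ⟨k, hk1, hk2⟩ := exists_two_rpow_lt_le h0 ht
    refine le_trans ?_ (ENNReal.le_tsum k)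
    rw [if_pos hk1, ENNReal.rpow_mul]
    exact ENNReal.rpow_le_rpow hk2 hp.le

/-- A dyadic substitute for the layer cake formula, lower bound. -/
theorem exists_tsum_dyadic_le {a : ℝ} (ha : 0 < a) :
    ∃ C : ℝ≥0∞, C ≠ ∞ ∧ ∀ s : ℝ≥0∞,
      ∑' k : ℤ, (if (2 : ℝ≥0∞) ^ (k : ℝ) < s then (2 : ℝ≥0∞) ^ (k * a) else 0) ≤ C * s ^ a := by
  obtain ⟨C, hC, h⟩ := exists_geometric_sum_le ha
  refine ⟨C + 1, by finiteness, fun s => ?_⟩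
  rcases eq_or_ne s 0 with rfl | h0
  · simp
  rcases eq_or_ne s ∞ with rfl | ht
  · simp [ENNReal.top_rpow_of_pos ha]
  · obtain ⟨K, hk1, hk2⟩ := exists_two_rpow_lt_le h0 ht
    calc _ ≤ ∑' k : ℤ, (if k ≤ K then (2 : ℝ≥0∞) ^ (k * a) else 0) := by
          refine ENNReal.tsum_le_tsum fun k => ?_
          by_cases hk : (2 : ℝ≥0∞) ^ (k : ℝ) < s
          · have := two_rpow_lt_iff.1 (hk.trans_le hk2)
            have : k < K + 1 := by exact_mod_cast this
            rw [if_pos hk, if_pos (by omega)]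
          · rw [if_neg hk]; exact zero_le
      _ ≤ C * 2 ^ (K * a) := h K
      _ ≤ (C + 1) * s ^ a := by
          rw [ENNReal.rpow_mul]
          gcongr
          exact le_self_add

/-! ### The Hardy–Littlewood maximal theorem -/

/-- The centered maximal function over balls of dyadic radius. -/
noncomputable def dyadicMax {n : ℕ} (F : RSpace n → ℝ≥0∞) (x : RSpace n) : ℝ≥0∞ :=
  ⨆ k : ℤ, (volume (Metric.closedBall (0 : RSpace n) ((2 : ℝ) ^ k)))⁻¹ *
    ∫⁻ y in Metric.closedBall x ((2 : ℝ) ^ k), F y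

section Maximal

variable {n : ℕ} {F : RSpace n → ℝ≥0∞}

theorem volume_closedBall_ne_zero (x : RSpace n) {r : ℝ} (hr : 0 < r) :
    volume (Metric.closedBall x r) ≠ 0 :=
  (Metric.measure_closedBall_pos volume x hr).ne'

theorem volume_closedBall_ne_top (x : RSpace n) (r : ℝ) :
    volume (Metric.closedBall x r) ≠ ∞ :=
  measure_closedBall_lt_top.ne

theorem lintegral_closedBall_le_dyadicMax (F : RSpace n → ℝ≥0∞) (x : RSpace n) (k : ℤ) :
    ∫⁻ y in Metric.closedBall x ((2 : ℝ) ^ k), F y ≤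
      volume (Metric.closedBall (0 : RSpace n) ((2 : ℝ) ^ k)) * dyadicMax F x := by
  have h := le_iSup (fun k : ℤ => (volume (Metric.closedBall (0 : RSpace n) ((2 : ℝ) ^ k)))⁻¹ *
    ∫⁻ y in Metric.closedBall x ((2 : ℝ) ^ k), F y) k
  have h2 : (0 : ℝ) < 2 ^ k := by positivity
  have := (ENNReal.inv_mul_le_iff (volume_closedBall_ne_zero (0 : RSpace n) h2)
    (volume_closedBall_ne_top _ _)).1 h
  exact this

theorem measurable_lintegral_closedBall (hF : Measurable F) (r : ℝ) :
    Measurable fun x => ∫⁻ y in Metric.closedBall x r, F y := by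
  have hS : MeasurableSet {z : RSpace n × RSpace n | dist z.2 z.1 ≤ r} :=
    measurableSet_le (measurable_snd.dist measurable_fst) measurable_const
  have h : Measurable (({z : RSpace n × RSpace n | dist z.2 z.1 ≤ r}).indicator
      fun z => F z.2) := (hF.comp measurable_snd).indicator hS
  convert h.lintegral_prod_right' (ν := volume) using 2 with x
  rw [← lintegral_indicator Metric.isClosed_closedBall.measurableSet]
  rfl

theorem measurable_dyadicMax (hF : Measurable F) : Measurable (dyadicMax F) :=
  Measurable.iSup fun _ => (measurable_lintegral_closedBall hF _).const_mul _

theorem dyadicMax_add_le (F : RSpace n → ℝ≥0∞) {G H : RSpace n → ℝ≥0∞} (hG : Measurable G)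
    (h : ∀ x, F x ≤ G x + H x) (x : RSpace n) :
    dyadicMax F x ≤ dyadicMax G x + dyadicMax H x := by
  refine iSup_le fun k => ?_
  calc _ ≤ (volume (Metric.closedBall (0 : RSpace n) ((2 : ℝ) ^ k)))⁻¹ *
        ∫⁻ y in Metric.closedBall x ((2 : ℝ) ^ k), (G y + H y) := by
        gcongr; exact h _
    _ = _ := by rw [lintegral_add_left hG, mul_add]
    _ ≤ _ := add_le_add
        (le_iSup (fun k : ℤ => (volume (Metric.closedBall (0 : RSpace n) ((2 : ℝ) ^ k)))⁻¹ *
          ∫⁻ y in Metric.closedBall x ((2 : ℝ) ^ k), G y) k)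
        (le_iSup (fun k : ℤ => (volume (Metric.closedBall (0 : RSpace n) ((2 : ℝ) ^ k)))⁻¹ *
          ∫⁻ y in Metric.closedBall x ((2 : ℝ) ^ k), H y) k)

theorem dyadicMax_le_of_le {t : ℝ≥0∞} (h : ∀ x, F x ≤ t) (x : RSpace n) :
    dyadicMax F x ≤ t := by
  refine iSup_le fun k => ?_
  have h2 : (0 : ℝ) < 2 ^ k := by positivity
  rw [ENNReal.inv_mul_le_iff (volume_closedBall_ne_zero (0 : RSpace n) h2)
    (volume_closedBall_ne_top _ _)]
  calc _ ≤ ∫⁻ y in Metric.closedBall x ((2 : ℝ) ^ k), t := lintegral_mono h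
    _ = _ := by
      rw [setLIntegral_const, Measure.addHaar_closedBall_center, mul_comm]

/-- The weak type `(1, 1)` bound. -/
theorem mul_volume_dyadicMax_le (hn : 0 < n) (F : RSpace n → ℝ≥0∞) (t : ℝ≥0∞) :
    t * volume {x | t < dyadicMax F x} ≤ 5 ^ n * ∫⁻ y, F y := by
  rcases eq_or_ne t 0 with rfl | ht0
  · simp
  rcases eq_or_ne t ∞ with rfl | htt
  · simp
  by_cases hI : ∫⁻ y, F y = ∞
  · rw [hI, ENNReal.mul_top (by positivity)]; exact le_top
  set S := {x | t < dyadicMax F x} with hS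
  have key : ∀ x : RSpace n, ∃ k : ℤ, x ∈ S →
      t * volume (Metric.closedBall x ((2 : ℝ) ^ k)) ≤
        ∫⁻ y in Metric.closedBall x ((2 : ℝ) ^ k), F y := by
    intro x
    by_cases hx : x ∈ S
    · obtain ⟨k, hk⟩ := lt_iSup_iff.1 (show t < dyadicMax F x from hx)
      refine ⟨k, fun _ => ?_⟩
      have h2 : (0 : ℝ) < 2 ^ k := by positivity
      rw [Measure.addHaar_closedBall_center, mul_comm]
      calc _ ≤ _ := mul_le_mul_right hk.le _
        _ = _ := ENNReal.mul_inv_cancel_left (volume_closedBall_ne_zero (0 : RSpace n) h2)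
          (volume_closedBall_ne_top _ _)
    · exact ⟨0, fun h => absurd h hx⟩
  choose k hk using key
  have hv0 : volume (Metric.closedBall (0 : RSpace n) 1) ≠ 0 :=
    volume_closedBall_ne_zero _ one_pos
  have hvt := volume_closedBall_ne_top (0 : RSpace n) 1
  have hball : ∀ (x : RSpace n) {r : ℝ}, 0 ≤ r → volume (Metric.closedBall x r) =
      ENNReal.ofReal r ^ n * volume (Metric.closedBall (0 : RSpace n) 1) := by
    intro x r hr
    have := Measure.addHaar_closedBall_mul (volume : Measure (RSpace n)) x hr (zero_le_one' ℝ)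
    rw [mul_one] at this
    rw [this, finrank_euclideanSpace_fin, ENNReal.ofReal_pow hr]
  -- Vitali's covering lemma needs bounded radii. A selected radius ρ ≥ 1 satisfies ρ ≤ ρ^n because
  -- n ≥ 1, so comparing t |B(x, ρ)| with the total integral gives ρ ≤ M.
  set M : ℝ≥0∞ := (∫⁻ y, F y) / (t * volume (Metric.closedBall (0 : RSpace n) 1)) with hM
  have hMt : M ≠ ∞ := ENNReal.div_ne_top hI (mul_ne_zero ht0 hv0)
  have hR : ∀ x ∈ S, (2 : ℝ) ^ k x ≤ max 1 M.toReal := by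
    intro x hx
    rcases le_total ((2 : ℝ) ^ k x) 1 with h1 | h1
    · exact h1.trans (le_max_left _ _)
    · refine le_trans ?_ (le_max_right _ _)
      rw [← ENNReal.ofReal_le_iff_le_toReal hMt, hM, ENNReal.le_div_iff_mul_le
        (Or.inl (mul_ne_zero ht0 hv0)) (Or.inl (ENNReal.mul_ne_top htt hvt))]
      have h3 := (hk x hx).trans (setLIntegral_le_lintegral _ _)
      rw [hball x (by positivity)] at h3
      refine le_trans ?_ h3
      calc _ = t * (ENNReal.ofReal (2 ^ k x) ^ 1 *
            volume (Metric.closedBall (0 : RSpace n) 1)) := by ring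
        _ ≤ _ := by
          gcongr
          · exact ENNReal.one_le_ofReal.2 h1
          · omega
  obtain ⟨u, huS, hdis, hcov⟩ := Vitali.exists_disjoint_subfamily_covering_enlargement_closedBall
    S (fun x => x) (fun x => (2 : ℝ) ^ k x) _ hR 5 (by norm_num)
  have hucount : u.Countable := by
    refine hdis.countable_of_nonempty_interior fun x hx => ?_
    have h2 : (0 : ℝ) < 2 ^ k x := by positivity
    exact (Metric.nonempty_ball.2 h2).mono Metric.ball_subset_interior_closedBall
  have hsub : S ⊆ ⋃ x ∈ u, Metric.closedBall x (5 * (2 : ℝ) ^ k x) := by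
    intro x hx
    obtain ⟨z, hz, hxz⟩ := hcov x hx
    exact Set.mem_biUnion hz (hxz (Metric.mem_closedBall_self (by positivity)))
  calc t * volume S ≤ t * ∑' x : u, volume (Metric.closedBall (x : RSpace n) (5 * (2 : ℝ) ^ k x)) := by
        gcongr
        exact (measure_mono hsub).trans (measure_biUnion_le _ hucount _)
    _ = 5 ^ n * ∑' x : u, t * volume (Metric.closedBall (x : RSpace n) ((2 : ℝ) ^ k x)) := by
        rw [← ENNReal.tsum_mul_left, ← ENNReal.tsum_mul_left]
        congr 1; ext x
        have h5 : (0 : ℝ) ≤ 2 ^ k (x : RSpace n) := by positivity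
        rw [hball _ (by positivity), hball _ h5, ENNReal.ofReal_mul (by norm_num), mul_pow]
        norm_num
        ring
    _ ≤ 5 ^ n * ∑' x : u, ∫⁻ y in Metric.closedBall (x : RSpace n) ((2 : ℝ) ^ k x), F y := by
        gcongr with x
        exact hk x (huS x.2)
    _ = 5 ^ n * ∫⁻ y in ⋃ x ∈ u, Metric.closedBall (x : RSpace n) ((2 : ℝ) ^ k x), F y := by
        rw [lintegral_biUnion hucount (fun x _ => Metric.isClosed_closedBall.measurableSet) hdis]
    _ ≤ _ := by gcongr; exact Measure.restrict_le_self

/-- The strong type `(p, p)` bound. -/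
theorem exists_lintegral_dyadicMax_rpow_le (hn : 0 < n) {p : ℝ} (hp : 1 < p) :
    ∃ C : ℝ≥0∞, C ≠ ∞ ∧ ∀ F : RSpace n → ℝ≥0∞, Measurable F →
      ∫⁻ x, dyadicMax F x ^ p ≤ C * ∫⁻ x, F x ^ p := by
  obtain ⟨C, hC, h⟩ := exists_tsum_dyadic_le (a := p - 1) (by linarith)
  have h5 : (5 : ℝ≥0∞) ^ n ≠ ∞ := ENNReal.pow_ne_top (by norm_num)
  refine ⟨5 ^ n * 2 ^ (2 * p) * C, by finiteness [two_rpow_ne_top (2 * p)], fun F hF => ?_⟩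
  -- at height `2 ^ (k + 1)` only the part of `F` above `2 ^ k` matters
  have hlevel : ∀ k : ℤ, (2 : ℝ≥0∞) ^ ((k : ℝ) + 1) *
      volume {x | (2 : ℝ≥0∞) ^ ((k : ℝ) + 1) < dyadicMax F x} ≤
      2 * 5 ^ n * ∫⁻ x, if (2 : ℝ≥0∞) ^ (k : ℝ) < F x then F x else 0 := by
    intro k
    set G : RSpace n → ℝ≥0∞ := fun x => if (2 : ℝ≥0∞) ^ (k : ℝ) < F x then F x else 0 with hG
    have hGm : Measurable G := Measurable.ite (measurableSet_lt measurable_const hF) hF measurable_const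
    have h2 : ∀ x, dyadicMax F x ≤ dyadicMax G x + 2 ^ (k : ℝ) := by
      intro x
      refine (dyadicMax_add_le F (H := fun x => min (F x) (2 ^ (k : ℝ))) hGm ?_ x).trans ?_
      · intro y
        by_cases hy : (2 : ℝ≥0∞) ^ (k : ℝ) < F y
        · simp only [hG]; rw [if_pos hy]; exact le_self_add
        · simp only [hG]; rw [if_neg hy, zero_add, min_eq_left (not_lt.1 hy)]
      · gcongr
        exact dyadicMax_le_of_le (fun y => min_le_right _ _) x
    have h3 : {x | (2 : ℝ≥0∞) ^ ((k : ℝ) + 1) < dyadicMax F x} ⊆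
        {x | (2 : ℝ≥0∞) ^ (k : ℝ) < dyadicMax G x} := by
      intro x hx
      simp only [Set.mem_ofPred_eq] at hx ⊢
      by_contra! h'
      refine absurd (hx.trans_le ((h2 x).trans (add_le_add_left h' _))) ?_
      rw [two_rpow_add, ENNReal.rpow_one, mul_two]
      exact lt_irrefl _
    calc _ ≤ 2 ^ ((k : ℝ) + 1) * volume {x | (2 : ℝ≥0∞) ^ (k : ℝ) < dyadicMax G x} := by
          gcongr
      _ = 2 * (2 ^ (k : ℝ) * volume {x | (2 : ℝ≥0∞) ^ (k : ℝ) < dyadicMax G x}) := by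
          rw [two_rpow_add, ENNReal.rpow_one]; ring
      _ ≤ 2 * (5 ^ n * ∫⁻ x, G x) := by
          exact mul_le_mul_right (mul_volume_dyadicMax_le hn G _) _
      _ = _ := by rw [mul_assoc]
  have hM := measurable_dyadicMax hF
  have hms : ∀ k : ℤ, MeasurableSet {x | (2 : ℝ≥0∞) ^ (k : ℝ) < dyadicMax F x} := fun k =>
    measurableSet_lt measurable_const hM
  calc ∫⁻ x, dyadicMax F x ^ p
      ≤ ∫⁻ x, ∑' k : ℤ, (if (2 : ℝ≥0∞) ^ (k : ℝ) < dyadicMax F x then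
          (2 : ℝ≥0∞) ^ (((k : ℝ) + 1) * p) else 0) :=
        lintegral_mono fun x => rpow_le_tsum_dyadic (by linarith) _
    _ = ∑' k : ℤ, 2 ^ (((k : ℝ) + 1) * p) * volume {x | (2 : ℝ≥0∞) ^ (k : ℝ) < dyadicMax F x} := by
        rw [lintegral_tsum fun k => (Measurable.ite (hms k) measurable_const
          measurable_const).aemeasurable]
        congr 1; ext k
        rw [← lintegral_indicator_const (hms k)]
        simp_rw [Set.indicator_apply, Set.mem_ofPred_eq]
    -- The shift matches the height 2^(k + 1) of `hlevel`. Exchanging sum and integral then leaves,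
    -- at each x, the sum of 2^(k(p - 1)) over 2^k < F(x), which is comparable to F(x)^(p - 1).
    _ = ∑' k : ℤ, 2 ^ (((k : ℝ) + 2) * p) *
          volume {x | (2 : ℝ≥0∞) ^ ((k : ℝ) + 1) < dyadicMax F x} := by
        rw [← (Equiv.addRight (1 : ℤ)).tsum_eq]
        congr 1; ext k
        simp only [Equiv.coe_addRight, Int.cast_add, Int.cast_one]
        ring_nf
    _ ≤ ∑' k : ℤ, 5 ^ n * 2 ^ (2 * p) * ∫⁻ x, F x *
          (if (2 : ℝ≥0∞) ^ (k : ℝ) < F x then 2 ^ (k * (p - 1)) else 0) := by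
        refine ENNReal.tsum_le_tsum fun k => ?_
        calc _ = 2 ^ ((k : ℝ) * (p - 1)) * 2 ^ (2 * p - 1) * (2 ^ ((k : ℝ) + 1) *
              volume {x | (2 : ℝ≥0∞) ^ ((k : ℝ) + 1) < dyadicMax F x}) := by
              rw [← mul_assoc, ← two_rpow_add, ← two_rpow_add]; ring_nf
          _ ≤ 2 ^ ((k : ℝ) * (p - 1)) * 2 ^ (2 * p - 1) * (2 * 5 ^ n * ∫⁻ x,
              if (2 : ℝ≥0∞) ^ (k : ℝ) < F x then F x else 0) := by
              exact mul_le_mul_right (hlevel k) _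
          _ = 5 ^ n * (2 ^ (2 * p - 1) * 2 ^ (1 : ℝ)) * (2 ^ ((k : ℝ) * (p - 1)) * ∫⁻ x,
              if (2 : ℝ≥0∞) ^ (k : ℝ) < F x then F x else 0) := by
              rw [ENNReal.rpow_one]; ring
          _ = _ := by
              rw [← two_rpow_add, sub_add_cancel, ← lintegral_const_mul' _ _ (two_rpow_ne_top _)]
              congr 2; ext x
              split_ifs <;> ring
    _ = 5 ^ n * 2 ^ (2 * p) * ∫⁻ x, F x * ∑' k : ℤ,
          (if (2 : ℝ≥0∞) ^ (k : ℝ) < F x then 2 ^ (k * (p - 1)) else 0) := by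
        rw [ENNReal.tsum_mul_left, ← lintegral_tsum]
        · simp_rw [ENNReal.tsum_mul_left]
        · exact fun k => (hF.mul (Measurable.ite (measurableSet_lt measurable_const hF)
            measurable_const measurable_const)).aemeasurable
    _ ≤ 5 ^ n * 2 ^ (2 * p) * ∫⁻ x, C * F x ^ p := by
        refine mul_le_mul_right (lintegral_mono fun x => ?_) _
        calc _ ≤ F x * (C * F x ^ (p - 1)) := by exact mul_le_mul_right (h _) _
          _ = C * (F x ^ (1 : ℝ) * F x ^ (p - 1)) := by rw [ENNReal.rpow_one]; ring
          _ = _ := by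
            rw [← ENNReal.rpow_add_of_nonneg _ _ zero_le_one (by linarith)]; ring_nf
    _ = _ := by
        rw [lintegral_const_mul' _ _ (by finiteness), mul_assoc, mul_assoc, mul_assoc]

end Maximal

/-! ### Cubes and Morrey norms -/

section Cubes

variable {n : ℕ}

theorem isClosed_axisCube (a : RSpace n) (r : ℝ) : IsClosed (axisCube a r) := by
  have : axisCube a r = ⋂ i, {x : RSpace n | a i ≤ x i ∧ x i ≤ a i + r} := by
    ext x; simp [axisCube]
  rw [this]
  refine isClosed_iInter fun i => ?_
  have hc : Continuous fun x : RSpace n => x i := by fun_prop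
  exact (isClosed_le continuous_const hc).inter (isClosed_le hc continuous_const)

theorem measurableSet_axisCube (a : RSpace n) (r : ℝ) : MeasurableSet (axisCube a r) :=
  (isClosed_axisCube a r).measurableSet

theorem volume_axisCube (a : RSpace n) (r : ℝ) :
    volume (axisCube a r) = ENNReal.ofReal r ^ n := by
  have h : axisCube a r = WithLp.ofLp ⁻¹'
      (Set.Icc (WithLp.ofLp a) (fun i => a i + r)) := by
    ext x
    simp only [axisCube, Set.mem_ofPred_eq, Set.mem_preimage, Set.mem_Icc, Pi.le_def, forall_and]
  rw [h, (PiLp.volume_preserving_ofLp (Fin n)).measure_preimage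
    measurableSet_Icc.nullMeasurableSet, Real.volume_Icc_pi]
  simp

theorem abs_coord_le_norm (x : RSpace n) (i : Fin n) : |x i| ≤ ‖x‖ := by
  simpa using PiLp.norm_apply_le x i

theorem closedBall_subset_axisCube (x : RSpace n) (r : ℝ) :
    Metric.closedBall x r ⊆ axisCube (WithLp.toLp 2 fun i => x i - r) (2 * r) := by
  intro y hy i
  have h := abs_le.1 ((abs_coord_le_norm (y - x) i).trans (mem_closedBall_iff_norm.1 hy))
  simp only [PiLp.sub_apply] at h
  constructor <;> simp only <;> linarith [h.1, h.2]

theorem mem_axisCube_of_norm_sub_le {a x y : RSpace n} {r : ℝ} (hx : x ∈ axisCube a r)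
    (h : ‖x - y‖ ≤ r) : y ∈ axisCube (WithLp.toLp 2 fun i => a i - r) (3 * r) := by
  intro i
  have h := abs_le.1 ((abs_coord_le_norm (x - y) i).trans h)
  have h' := hx i
  simp only [PiLp.sub_apply] at h
  constructor <;> simp only <;> linarith [h.1, h.2, h'.1, h'.2]

/-- The Morrey norm of a function with values in `[0, ∞]`. -/
noncomputable def emorreyNorm (p lam : ℝ) (F : RSpace n → ℝ≥0∞) : ℝ≥0∞ :=
  ⨆ (a : RSpace n) (r : ℝ) (_ : 0 < r),
    (volume (axisCube a r)) ^ (-(lam / n)) *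
      ((volume (axisCube a r))⁻¹ * ∫⁻ y in axisCube a r, F y ^ p) ^ (1 / p)

theorem morreyNorm_eq (p lam : ℝ) (f : RSpace n → ℝ) :
    morreyNorm p lam f = emorreyNorm p lam fun y => ‖f y‖ₑ := rfl

/-- As |Q| = r^n, all powers of |Q| merge into r^(n + λp). This inverse-free form is the one in
which Morrey bounds are proved and used. -/
theorem morrey_term_le_iff (hn : 0 < n) {p lam r : ℝ} (hp : 0 < p) (hr : 0 < r) (a : RSpace n)
    (I A : ℝ≥0∞) :
    (volume (axisCube a r)) ^ (-(lam / n)) * ((volume (axisCube a r))⁻¹ * I) ^ (1 / p) ≤ A ↔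
      I ≤ ENNReal.ofReal r ^ (n + lam * p) * A ^ p := by
  have hn' : (n : ℝ) ≠ 0 := by positivity
  have hR0 : ENNReal.ofReal r ≠ 0 := by simpa using hr
  have hRt : ENNReal.ofReal r ≠ ∞ := ENNReal.ofReal_ne_top
  set R := ENNReal.ofReal r
  have hV0 : R ^ (n : ℝ) ≠ 0 := by simp [hR0]
  have hVt : R ^ (n : ℝ) ≠ ∞ := ENNReal.rpow_ne_top_of_ne_zero hR0 hRt
  have hL0 : R ^ lam ≠ 0 := by simp [ENNReal.rpow_eq_zero_iff, hR0, hRt]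
  have hLt : R ^ lam ≠ ∞ := ENNReal.rpow_ne_top_of_ne_zero hR0 hRt
  rw [volume_axisCube, ← ENNReal.rpow_natCast, ← ENNReal.rpow_mul,
    show (n : ℝ) * -(lam / n) = -lam by field_simp, ENNReal.rpow_neg,
    ENNReal.inv_mul_le_iff hL0 hLt, one_div, ENNReal.rpow_inv_le_iff hp,
    ENNReal.inv_mul_le_iff hV0 hVt, ENNReal.mul_rpow_of_nonneg _ _ hp.le, ← ENNReal.rpow_mul,
    ← mul_assoc, ← ENNReal.rpow_add _ _ hR0 hRt]

theorem emorreyNorm_le_iff (hn : 0 < n) {p lam : ℝ} (hp : 0 < p) {F : RSpace n → ℝ≥0∞}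
    {A : ℝ≥0∞} :
    emorreyNorm p lam F ≤ A ↔ ∀ (a : RSpace n) (r : ℝ), 0 < r →
      ∫⁻ y in axisCube a r, F y ^ p ≤ ENNReal.ofReal r ^ (n + lam * p) * A ^ p := by
  simp only [emorreyNorm, iSup_le_iff]
  exact forall_congr' fun a => forall_congr' fun r => forall_congr' fun hr =>
    morrey_term_le_iff hn hp hr a _ _

theorem setLIntegral_axisCube_rpow_le (hn : 0 < n) {p lam r : ℝ} (hp : 0 < p) (hr : 0 < r)
    (F : RSpace n → ℝ≥0∞) (a : RSpace n) :
    ∫⁻ y in axisCube a r, F y ^ p ≤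
      ENNReal.ofReal r ^ (n + lam * p) * emorreyNorm p lam F ^ p :=
  (emorreyNorm_le_iff hn hp).1 le_rfl a r hr

/-- Hölder's inequality against the constant 1: the exponents of r add up as (n + λp)/p + n(1 - 1/p)
= n + λ. -/
theorem setLIntegral_axisCube_le (hn : 0 < n) {p lam r : ℝ} (hp : 1 < p) (hr : 0 < r)
    {F : RSpace n → ℝ≥0∞} (hF : AEMeasurable F) (a : RSpace n) :
    ∫⁻ y in axisCube a r, F y ≤ ENNReal.ofReal r ^ (n + lam) * emorreyNorm p lam F := by
  have hp0 : 0 < p := by linarith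
  have hR0 : ENNReal.ofReal r ≠ 0 := by simpa using hr
  have hRt : ENNReal.ofReal r ≠ ∞ := ENNReal.ofReal_ne_top
  have hpq := Real.HolderConjugate.conjExponent hp
  have h := ENNReal.lintegral_mul_le_Lp_mul_Lq (volume.restrict (axisCube a r)) hpq
    hF.restrict (aemeasurable_const (b := (1 : ℝ≥0∞)))
  simp only [Pi.mul_apply, mul_one, ENNReal.one_rpow, lintegral_const, one_mul,
    Measure.restrict_apply_univ] at h
  refine h.trans ?_
  calc _ ≤ (ENNReal.ofReal r ^ (n + lam * p) * emorreyNorm p lam F ^ p) ^ (1 / p) *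
        volume (axisCube a r) ^ (1 / p.conjExponent) := by
        gcongr
        exact setLIntegral_axisCube_rpow_le hn hp0 hr F a
    _ = _ := by
        rw [volume_axisCube, ← ENNReal.rpow_natCast, ← ENNReal.rpow_mul,
          ENNReal.mul_rpow_of_nonneg _ _ (by positivity), ← ENNReal.rpow_mul, ← ENNReal.rpow_mul,
          mul_one_div_cancel hp0.ne', ENNReal.rpow_one, mul_right_comm,
          ← ENNReal.rpow_add _ _ hR0 hRt]
        congr 2
        rw [one_div p.conjExponent, ← hpq.one_sub_inv]
        field_simp
        ring

theorem setLIntegral_closedBall_le (hn : 0 < n) {p lam r : ℝ} (hp : 1 < p) (hr : 0 < r)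
    {F : RSpace n → ℝ≥0∞} (hF : AEMeasurable F) (x : RSpace n) :
    ∫⁻ y in Metric.closedBall x r, F y ≤
      ENNReal.ofReal (2 * r) ^ (n + lam) * emorreyNorm p lam F :=
  (lintegral_mono_set (closedBall_subset_axisCube x r)).trans
    (setLIntegral_axisCube_le hn hp (by positivity) hF _)

theorem iUnion_axisCube_eq_univ :
    ⋃ m : ℕ, axisCube (WithLp.toLp 2 fun _ : Fin n => -(m : ℝ)) (2 * (m + 1)) = Set.univ := by
  refine Set.eq_univ_of_forall fun x => ?_
  obtain ⟨m, hm⟩ := exists_nat_ge ‖x‖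
  refine Set.mem_iUnion.2 ⟨m, fun i => ?_⟩
  have := abs_le.1 ((abs_coord_le_norm x i).trans hm)
  constructor <;> simp only <;> linarith [this.1, this.2]

/-- For λ = -n/p the exponent n + λp vanishes, so the supremum is a monotone limit over cubes
exhausting the space. This makes the Lebesgue statements special cases of the Morrey ones. -/
theorem emorreyNorm_neg_div (hn : 0 < n) {p : ℝ} (hp : 0 < p) (F : RSpace n → ℝ≥0∞) :
    emorreyNorm p (-(n : ℝ) / p) F = (∫⁻ y, F y ^ p) ^ (1 / p) := by
  have h0 : (n : ℝ) + -(n : ℝ) / p * p = 0 := by field_simp; ring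
  apply le_antisymm
  · rw [emorreyNorm_le_iff hn hp]
    intro a r hr
    rw [h0, ENNReal.rpow_zero, one_mul, ← ENNReal.rpow_mul, one_div_mul_cancel hp.ne',
      ENNReal.rpow_one]
    exact setLIntegral_le_lintegral _ _
  · rw [one_div, ENNReal.rpow_inv_le_iff hp, ← setLIntegral_univ, ← iUnion_axisCube_eq_univ,
      setLIntegral_iUnion_of_directed]
    · refine iSup_le fun m => ?_
      have := setLIntegral_axisCube_rpow_le hn (lam := -(n : ℝ) / p) (r := 2 * (m + 1)) hp (by positivity) F
        (WithLp.toLp 2 fun _ : Fin n => -(m : ℝ))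
      rwa [h0, ENNReal.rpow_zero, one_mul] at this
    · refine Monotone.directed_le (monotone_nat_of_le_succ fun m x hx i => ?_)
      have := hx i
      push_cast
      simp only at this ⊢
      constructor <;> linarith [this.1, this.2]

theorem morreyNorm_neg_div (hn : 0 < n) {p : ℝ} (hp : 0 < p) (f : RSpace n → ℝ) :
    morreyNorm p (-(n : ℝ) / p) f = lebesgueNorm p f := by
  rw [morreyNorm_eq, emorreyNorm_neg_div hn hp, lebesgueNorm, eLpNorm_eq_lintegral_rpow_enorm_toReal (by simpa using hp)
    ENNReal.ofReal_ne_top, ENNReal.toReal_ofReal hp.le]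

end Cubes

/-! ### Riesz potentials and Hedberg's inequality -/

/-- The kernel `|z|^{γ - n}` of the Riesz potential. -/
noncomputable def rieszKernel {n : ℕ} (γ : ℝ) (z : RSpace n) : ℝ≥0∞ :=
  ENNReal.ofReal (‖z‖ ^ (γ - n))

/-- The (unnormalized) Riesz potential of a nonnegative function. -/
noncomputable def rieszPotential {n : ℕ} (γ : ℝ) (F : RSpace n → ℝ≥0∞) (x : RSpace n) : ℝ≥0∞ :=
  ∫⁻ y, rieszKernel γ (x - y) * F y

section Riesz

variable {n : ℕ} {γ : ℝ} {F : RSpace n → ℝ≥0∞}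

theorem ofReal_two_zpow (k : ℤ) : ENNReal.ofReal ((2 : ℝ) ^ k) = 2 ^ (k : ℝ) := by
  rw [← Real.rpow_intCast, ← ENNReal.ofReal_rpow_of_pos (by norm_num)]
  norm_num

theorem ofReal_two_zpow_rpow (k : ℤ) (a : ℝ) :
    ENNReal.ofReal (((2 : ℝ) ^ k) ^ a) = 2 ^ (k * a) := by
  rw [← ENNReal.ofReal_rpow_of_pos (by positivity), ofReal_two_zpow, ENNReal.rpow_mul]

theorem measurable_rieszKernel : Measurable (rieszKernel (n := n) γ) := by
  unfold rieszKernel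
  fun_prop

/-- If 2^j < ‖z‖ ≤ 2^(j + 1), the single term k = j + 1 already dominates. Keeping the condition δ ≤
2^k lets the same majorant serve both the whole potential (δ = 0) and its tails. -/
theorem rieszKernel_le (hγ : γ < n) (δ : ℝ) {z : RSpace n} (hz : δ ≤ ‖z‖) :
    rieszKernel γ z ≤ ∑' k : ℤ, if δ ≤ (2 : ℝ) ^ k ∧ ‖z‖ ≤ 2 ^ k then
      (2 : ℝ≥0∞) ^ ((n : ℝ) - γ) * 2 ^ ((k : ℝ) * (γ - n)) else 0 := by
  rcases eq_or_ne z 0 with rfl | h0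
  -- With real powers, 0 raised to a nonzero exponent is 0, so the kernel vanishes at the origin
  -- instead of being infinite.
  · simp [rieszKernel, Real.zero_rpow (by linarith : γ - n ≠ 0)]
  have hz0 : 0 < ‖z‖ := norm_pos_iff.2 h0
  obtain ⟨j, hj1, hj2⟩ := exists_mem_Ioc_zpow hz0 (by norm_num : (1 : ℝ) < 2)
  refine le_trans ?_ (ENNReal.le_tsum (j + 1))
  rw [if_pos ⟨hz.trans hj2, hj2⟩]
  calc rieszKernel γ z ≤ ENNReal.ofReal (((2 : ℝ) ^ j) ^ (γ - n)) :=
        ENNReal.ofReal_le_ofReal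
          (Real.rpow_le_rpow_of_nonpos (by positivity) hj1.le (by linarith))
    _ = _ := by
        rw [ofReal_two_zpow_rpow, ← two_rpow_add]
        congr 1; push_cast; ring

theorem setLIntegral_rieszKernel_mul_le (hγ : γ < n) (hF : Measurable F) (δ : ℝ) (x : RSpace n) :
    ∫⁻ y in {y | δ ≤ ‖x - y‖}, rieszKernel γ (x - y) * F y ≤
      2 ^ ((n : ℝ) - γ) * ∑' k : ℤ, if δ ≤ (2 : ℝ) ^ k then
        2 ^ ((k : ℝ) * (γ - n)) * ∫⁻ y in Metric.closedBall x ((2 : ℝ) ^ k), F y else 0 := by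
  have hS : MeasurableSet {y : RSpace n | δ ≤ ‖x - y‖} :=
    measurableSet_le measurable_const (by fun_prop)
  calc _ ≤ ∫⁻ y in {y | δ ≤ ‖x - y‖}, ∑' k : ℤ, (if δ ≤ (2 : ℝ) ^ k then
        (2 : ℝ≥0∞) ^ ((n : ℝ) - γ) * 2 ^ ((k : ℝ) * (γ - n)) else 0) *
          (Metric.closedBall x ((2 : ℝ) ^ k)).indicator F y := by
        refine setLIntegral_mono' hS fun y hy => ?_
        refine (mul_le_mul_left (rieszKernel_le hγ δ hy) _).trans_eq ?_
        rw [← ENNReal.tsum_mul_right]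
        congr 1; ext k
        by_cases h1 : δ ≤ (2 : ℝ) ^ k
        · by_cases h2 : ‖x - y‖ ≤ 2 ^ k
          · rw [if_pos ⟨h1, h2⟩, if_pos h1, Set.indicator_of_mem (mem_closedBall_iff_norm'.2 h2)]
          · rw [if_neg fun h => h2 h.2, zero_mul,
              Set.indicator_of_notMem fun h => h2 (mem_closedBall_iff_norm'.1 h), mul_zero]
        · rw [if_neg fun h => h1 h.1, if_neg h1, zero_mul, zero_mul]
    _ ≤ ∫⁻ y, ∑' k : ℤ, (if δ ≤ (2 : ℝ) ^ k then
        (2 : ℝ≥0∞) ^ ((n : ℝ) - γ) * 2 ^ ((k : ℝ) * (γ - n)) else 0) *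
          (Metric.closedBall x ((2 : ℝ) ^ k)).indicator F y := setLIntegral_le_lintegral _ _
    _ = _ := by
        rw [lintegral_tsum fun k =>
          ((hF.indicator Metric.isClosed_closedBall.measurableSet).const_mul _).aemeasurable,
          ← ENNReal.tsum_mul_left]
        congr 1; ext k
        rw [lintegral_const_mul _ (hF.indicator Metric.isClosed_closedBall.measurableSet),
          lintegral_indicator Metric.isClosed_closedBall.measurableSet]
        split_ifs <;> simp [mul_assoc]

theorem measurable_rieszPotential (hF : Measurable F) : Measurable (rieszPotential γ F) := by
  have h : Measurable fun z : RSpace n × RSpace n => rieszKernel γ (z.1 - z.2) * F z.2 :=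
    (measurable_rieszKernel.comp (measurable_fst.sub measurable_snd)).mul (hF.comp measurable_snd)
  exact h.lintegral_prod_right' (ν := volume)

theorem rieszPotential_le (hγ : γ < n) (hF : Measurable F) (x : RSpace n) :
    rieszPotential γ F x ≤ 2 ^ ((n : ℝ) - γ) * ∑' k : ℤ,
      2 ^ ((k : ℝ) * (γ - n)) * ∫⁻ y in Metric.closedBall x ((2 : ℝ) ^ k), F y := by
  have h := setLIntegral_rieszKernel_mul_le hγ hF 0 x
  have h0 : {y : RSpace n | 0 ≤ ‖x - y‖} = Set.univ := by ext; simp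
  have h1 : ∀ k : ℤ, (0 : ℝ) ≤ 2 ^ k := fun k => by positivity
  simp only [h0, setLIntegral_univ, h1, if_true] at h
  exact h

theorem two_rpow_mul_setLIntegral_closedBall_le (hn : 0 < n) {p : ℝ} (lam : ℝ) (hp : 1 < p)
    (hF : Measurable F) (x : RSpace n) (k : ℤ) :
    2 ^ ((k : ℝ) * (γ - n)) * ∫⁻ y in Metric.closedBall x ((2 : ℝ) ^ k), F y ≤
      2 ^ ((k : ℝ) * (γ + lam)) * (2 ^ ((n : ℝ) + lam) * emorreyNorm p lam F) := by
  refine (mul_le_mul_right (setLIntegral_closedBall_le hn (lam := lam) hp (by positivity)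
    hF.aemeasurable x) _).trans_eq ?_
  have : (2 : ℝ) * 2 ^ k = 2 ^ (k + 1) := by rw [zpow_add_one₀ (by norm_num)]; ring
  rw [this, ofReal_two_zpow, ← ENNReal.rpow_mul, ← mul_assoc, ← mul_assoc, ← two_rpow_add,
    ← two_rpow_add]
  congr 2
  push_cast; ring

/-- Away from the singularity the Riesz potential is controlled by the Morrey norm alone. -/
theorem exists_setLIntegral_rieszKernel_le (hn : 0 < n) {p lam : ℝ} (hγ : γ < n) (hp : 1 < p)
    (hlam : γ + lam < 0) :
    ∃ C : ℝ≥0∞, C ≠ ∞ ∧ ∀ F : RSpace n → ℝ≥0∞, Measurable F → ∀ (x : RSpace n) (δ : ℝ), 0 < δ →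
      ∫⁻ y in {y | δ ≤ ‖x - y‖}, rieszKernel γ (x - y) * F y ≤
        C * ENNReal.ofReal δ ^ (γ + lam) * emorreyNorm p lam F := by
  obtain ⟨C, hC, h⟩ := exists_geometric_sum_ge hlam
  refine ⟨2 ^ ((n : ℝ) - γ) * (2 ^ ((n : ℝ) + lam) * C), ?_, fun F hF x δ hδ => ?_⟩
  · finiteness [two_rpow_ne_top ((n : ℝ) - γ), two_rpow_ne_top ((n : ℝ) + lam)]
  -- Only scales k ≥ j + 1 survive. Their sum is governed by the smallest one, and 2^((j + 1)(γ +
  -- λ)) ≤ δ^(γ + λ) because γ + λ < 0 and δ ≤ 2^(j + 1).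
  obtain ⟨j, hj1, hj2⟩ := exists_mem_Ioc_zpow hδ (by norm_num : (1 : ℝ) < 2)
  calc _ ≤ _ := setLIntegral_rieszKernel_mul_le hγ hF δ x
    _ ≤ 2 ^ ((n : ℝ) - γ) * ∑' k : ℤ, (if j + 1 ≤ k then (2 : ℝ≥0∞) ^ (k * (γ + lam)) else 0) *
          (2 ^ ((n : ℝ) + lam) * emorreyNorm p lam F) := by
        refine mul_le_mul_right (ENNReal.tsum_le_tsum fun k => ?_) _
        by_cases hk : δ ≤ (2 : ℝ) ^ k
        · have hjk : j < k := (zpow_lt_zpow_iff_right₀ (by norm_num : (1 : ℝ) < 2)).1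
            (hj1.trans_le hk)
          rw [if_pos hk, if_pos (by omega)]
          exact two_rpow_mul_setLIntegral_closedBall_le hn lam hp hF x k
        · rw [if_neg hk]; exact zero_le
    _ ≤ 2 ^ ((n : ℝ) - γ) * (C * 2 ^ (((j + 1 : ℤ) : ℝ) * (γ + lam)) *
          (2 ^ ((n : ℝ) + lam) * emorreyNorm p lam F)) := by
        rw [ENNReal.tsum_mul_right]
        exact mul_le_mul_right (mul_le_mul_left (h _) _) _
    _ ≤ 2 ^ ((n : ℝ) - γ) * (C * ENNReal.ofReal δ ^ (γ + lam) *
          (2 ^ ((n : ℝ) + lam) * emorreyNorm p lam F)) := by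
        refine mul_le_mul_right (mul_le_mul_left (mul_le_mul_right ?_ _) _) _
        rw [← ofReal_two_zpow_rpow, ENNReal.ofReal_rpow_of_pos hδ]
        exact ENNReal.ofReal_le_ofReal (Real.rpow_le_rpow_of_nonpos hδ hj2 hlam.le)
    _ = _ := by ring

/-- Optimization of a two-sided geometric sum. -/
theorem exists_tsum_le_rpow_mul_rpow {a c : ℝ} (ha : 0 < a) (hc : a < c) :
    ∃ C : ℝ≥0∞, C ≠ ∞ ∧ ∀ (A N : ℝ≥0∞) (u : ℤ → ℝ≥0∞), (∀ k : ℤ, u k ≤ 2 ^ (k * a) * A) →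
      (∀ k : ℤ, u k ≤ 2 ^ (k * (a - c)) * N) → ∑' k, u k ≤ C * (A ^ (1 - a / c) * N ^ (a / c)) := by
  obtain ⟨C₁, hC₁, h₁⟩ := exists_geometric_sum_le ha
  obtain ⟨C₂, hC₂, h₂⟩ := exists_geometric_sum_ge (a := a - c) (by linarith)
  have hc0 : 0 < c := ha.trans hc
  have hθ1 : a / c < 1 := (div_lt_one hc0).2 hc
  have hθ0 : 0 < a / c := by positivity
  -- The summand 1 keeps the constant nonzero, so that its product with ∞ is ∞ in the degenerate
  -- cases.
  refine ⟨C₁ + C₂ + 1, by finiteness, fun A N u hA hN => ?_⟩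
  rcases eq_or_ne A 0 with rfl | hA0
  · have : ∀ k, u k = 0 := fun k => by simpa using hA k
    simp [this]
  rcases eq_or_ne N 0 with rfl | hN0
  · have : ∀ k, u k = 0 := fun k => by simpa using hN k
    simp [this]
  rcases eq_or_ne A ∞ with rfl | hAt
  · rw [ENNReal.top_rpow_of_pos (by linarith), ENNReal.top_mul, ENNReal.mul_top (by simp)]
    · exact le_top
    · simp [ENNReal.rpow_eq_zero_iff, hN0, hθ0.not_gt]
  rcases eq_or_ne N ∞ with rfl | hNt
  · rw [ENNReal.top_rpow_of_pos hθ0, ENNReal.mul_top, ENNReal.mul_top (by simp)]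
    · exact le_top
    · have : ¬ (1 - a / c < 0) := by linarith
      simp [ENNReal.rpow_eq_zero_iff, hA0, hAt]
  have hs0 : N / A ≠ 0 := ENNReal.div_ne_zero.2 ⟨hN0, hAt⟩
  have hst : N / A ≠ ∞ := ENNReal.div_ne_top hNt hA0
  -- The two bounds on u balance where 2^(kc) = N / A, so the sum is cut at 2^K ≈ (N / A)^(1/c).
  obtain ⟨K, hK1, hK2⟩ := exists_two_rpow_lt_le (s := (N / A) ^ (1 / c))
    (by simp [ENNReal.rpow_eq_zero_iff, hs0, hst])
    (ENNReal.rpow_ne_top_of_ne_zero hs0 hst)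
  have e1 : ((N / A) ^ (1 / c)) ^ a * A = A ^ (1 - a / c) * N ^ (a / c) := by
    rw [← ENNReal.rpow_mul, one_div_mul_eq_div, ENNReal.div_rpow_of_nonneg _ _ hθ0.le,
      ENNReal.rpow_sub _ _ hA0 hAt, ENNReal.rpow_one, ENNReal.div_eq_inv_mul,
      ENNReal.div_eq_inv_mul]
    ring
  have e2 : ((N / A) ^ (1 / c)) ^ (a - c) * N = A ^ (1 - a / c) * N ^ (a / c) := by
    rw [← ENNReal.rpow_mul, show 1 / c * (a - c) = -(1 - a / c) by field_simp; ring,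
      ENNReal.rpow_neg, ENNReal.div_rpow_of_nonneg _ _ (by linarith), ENNReal.inv_div
      (Or.inl (ENNReal.rpow_ne_top_of_ne_zero hA0 hAt))
      (Or.inl (by simp [ENNReal.rpow_eq_zero_iff, hA0, hAt])), ENNReal.div_eq_inv_mul,
      ← ENNReal.rpow_neg, mul_right_comm, mul_comm]
    congr 1
    calc N ^ (-(1 - a / c)) * N = N ^ (-(1 - a / c)) * N ^ (1 : ℝ) := by rw [ENNReal.rpow_one]
      _ = _ := by rw [← ENNReal.rpow_add _ _ hN0 hNt]; ring_nf
  calc ∑' k, u k ≤ ∑' k : ℤ, ((if k ≤ K then (2 : ℝ≥0∞) ^ (k * a) else 0) * A +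
        (if K + 1 ≤ k then (2 : ℝ≥0∞) ^ (k * (a - c)) else 0) * N) := by
        refine ENNReal.tsum_le_tsum fun k => ?_
        by_cases hk : k ≤ K
        · rw [if_pos hk]; exact (hA k).trans le_self_add
        · rw [if_neg hk, if_pos (by omega), zero_mul, zero_add]; exact hN k
    _ ≤ C₁ * 2 ^ (K * a) * A + C₂ * 2 ^ (((K + 1 : ℤ) : ℝ) * (a - c)) * N := by
        rw [ENNReal.tsum_add, ENNReal.tsum_mul_right, ENNReal.tsum_mul_right]
        exact add_le_add (mul_le_mul_left (h₁ K) _) (mul_le_mul_left (h₂ _) _)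
    _ ≤ C₁ * ((N / A) ^ (1 / c)) ^ a * A + C₂ * ((N / A) ^ (1 / c)) ^ (a - c) * N := by
        refine add_le_add (mul_le_mul_left (mul_le_mul_right ?_ _) _)
          (mul_le_mul_left (mul_le_mul_right ?_ _) _)
        · rw [ENNReal.rpow_mul]
          exact ENNReal.rpow_le_rpow hK1.le ha.le
        · rw [ENNReal.rpow_mul, show a - c = -(c - a) by ring, ENNReal.rpow_neg, ENNReal.rpow_neg]
          push_cast
          exact ENNReal.inv_le_inv.2 (ENNReal.rpow_le_rpow hK2 (by linarith))
    _ = (C₁ + C₂) * (A ^ (1 - a / c) * N ^ (a / c)) := by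
        rw [mul_assoc, mul_assoc, e1, e2]; ring
    _ ≤ _ := mul_le_mul_left le_self_add _

/-- Hedberg's pointwise inequality. -/
theorem exists_rieszPotential_le_dyadicMax (hn : 0 < n) {p lam : ℝ} (hγ0 : 0 < γ) (hγ : γ < n)
    (hp : 1 < p) (hlam : γ + lam < 0) :
    ∃ C : ℝ≥0∞, C ≠ ∞ ∧ ∀ F : RSpace n → ℝ≥0∞, Measurable F → ∀ x : RSpace n,
      rieszPotential γ F x ≤
        C * (dyadicMax F x ^ (1 - γ / (-lam)) * emorreyNorm p lam F ^ (γ / (-lam))) := by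
  obtain ⟨C, hC, h⟩ := exists_tsum_le_rpow_mul_rpow hγ0 (show γ < -lam by linarith)
  set v := volume (Metric.closedBall (0 : RSpace n) 1)
  have hv : v ≠ ∞ := volume_closedBall_ne_top _ _
  have hl : 0 < -lam := by linarith
  have hθ1 : 0 ≤ 1 - γ / (-lam) := by
    have := (div_lt_one hl).2 (show γ < -lam by linarith); linarith
  have hθ0 : 0 ≤ γ / (-lam) := by positivity
  refine ⟨2 ^ ((n : ℝ) - γ) * (C * (v ^ (1 - γ / (-lam)) *
    (2 ^ ((n : ℝ) + lam)) ^ (γ / (-lam)))), ?_, fun F hF x => ?_⟩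
  · have h1 := ENNReal.rpow_ne_top_of_nonneg hθ1 hv
    have h2 := ENNReal.rpow_ne_top_of_nonneg hθ0 (two_rpow_ne_top (n + lam))
    finiteness [two_rpow_ne_top ((n : ℝ) - γ)]
  refine (rieszPotential_le hγ hF x).trans ?_
  -- The integral over the ball of radius 2^k is bounded in two ways: by the maximal function, which
  -- is good at small scales, and by the Morrey norm, which is good at large ones.
  refine (mul_le_mul_right (h (v * dyadicMax F x) (2 ^ ((n : ℝ) + lam) * emorreyNorm p lam F) _
    (fun k => ?_) fun k => ?_) _).trans_eq ?_
  · have h2 : (0 : ℝ) ≤ 2 ^ k := by positivity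
    have := Measure.addHaar_closedBall_mul (volume : Measure (RSpace n)) 0 h2 (zero_le_one' ℝ)
    rw [mul_one, finrank_euclideanSpace_fin, ENNReal.ofReal_pow h2, ofReal_two_zpow,
      ← ENNReal.rpow_natCast, ← ENNReal.rpow_mul] at this
    refine (mul_le_mul_right (lintegral_closedBall_le_dyadicMax F x k) _).trans_eq ?_
    rw [this, ← mul_assoc, ← mul_assoc, ← mul_assoc, ← two_rpow_add]
    congr 3; ring
  · have := two_rpow_mul_setLIntegral_closedBall_le (γ := γ) hn lam hp hF x k
    rwa [show γ - -lam = γ + lam by ring]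
  · rw [ENNReal.mul_rpow_of_nonneg _ _ hθ1, ENNReal.mul_rpow_of_nonneg _ _ hθ0]
    ring

end Riesz

/-! ### Boundedness of the Riesz potential on Lebesgue and Morrey spaces -/

section HardyLittlewoodSobolev

variable {n : ℕ} {γ : ℝ}

/-- The Hardy–Littlewood–Sobolev inequality. -/
theorem exists_lintegral_rieszPotential_rpow_le (hn : 0 < n) {p q : ℝ} (hγ0 : 0 < γ)
    (hγ : γ < n) (hp : 1 < p) (hq : 1 < q) (hpq : 1 / q = 1 / p - γ / n) :
    ∃ C : ℝ≥0∞, C ≠ ∞ ∧ ∀ F : RSpace n → ℝ≥0∞, Measurable F →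
      ∫⁻ x, rieszPotential γ F x ^ q ≤ C * (∫⁻ x, F x ^ p) ^ (q / p) := by
  have hn' : (0 : ℝ) < n := by exact_mod_cast hn
  have hp0 : 0 < p := by linarith
  have hq0 : 0 < q := by linarith
  have hlam : γ + -(n : ℝ) / p < 0 := by
    have h1 : 0 < 1 / p - γ / n := by rw [← hpq]; positivity
    have h2 : γ + -(n : ℝ) / p = -(n * (1 / p - γ / n)) := by field_simp; ring
    rw [h2]; have := mul_pos hn' h1; linarith
  obtain ⟨C₁, hC₁, h₁⟩ := exists_rieszPotential_le_dyadicMax hn hγ0 hγ hp hlam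
  obtain ⟨C₂, hC₂, h₂⟩ := exists_lintegral_dyadicMax_rpow_le hn hp
  -- For λ = -n/p Hedberg's exponent on the maximal function becomes p/q, so its q-th power is
  -- exactly the p-th power handled by the maximal theorem.
  have hθ : γ / -(-(n : ℝ) / p) = 1 - p / q := by
    have : γ / -(-(n : ℝ) / p) = p * (γ / n) := by field_simp
    rw [this, show γ / n = 1 / p - 1 / q by linarith]; field_simp
  rw [hθ] at h₁
  have hθ0 : 0 ≤ 1 - p / q := by rw [← hθ, neg_div, neg_neg]; positivity
  refine ⟨C₁ ^ q * C₂, ?_, fun F hF => ?_⟩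
  · have := ENNReal.rpow_ne_top_of_nonneg hq0.le hC₁
    finiteness
  set J := ∫⁻ x, F x ^ p with hJ
  calc ∫⁻ x, rieszPotential γ F x ^ q
      ≤ ∫⁻ x, C₁ ^ q * J ^ (q / p - 1) * dyadicMax F x ^ p := by
        refine lintegral_mono fun x => ?_
        refine (ENNReal.rpow_le_rpow (h₁ F hF x) hq0.le).trans_eq ?_
        rw [emorreyNorm_neg_div hn hp0, ← hJ, ENNReal.mul_rpow_of_nonneg _ _ hq0.le,
          ENNReal.mul_rpow_of_nonneg _ _ hq0.le, ← ENNReal.rpow_mul, ← ENNReal.rpow_mul,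
          ← ENNReal.rpow_mul, mul_assoc, mul_comm (dyadicMax F x ^ _)]
        congr 3
        · field_simp
        · field_simp; ring
    _ = C₁ ^ q * J ^ (q / p - 1) * ∫⁻ x, dyadicMax F x ^ p :=
        lintegral_const_mul _ ((measurable_dyadicMax hF).pow_const p)
    _ ≤ C₁ ^ q * J ^ (q / p - 1) * (C₂ * J) := mul_le_mul_right (h₂ F hF) _
    _ = C₁ ^ q * C₂ * (J ^ (q / p - 1) * J ^ (1 : ℝ)) := by rw [ENNReal.rpow_one]; ring
    _ = _ := by
        have : 0 ≤ q / p - 1 := by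
          have h : q / p - 1 = (1 - p / q) * (q / p) := by field_simp
          rw [h]; positivity
        rw [← ENNReal.rpow_add_of_nonneg _ _ this zero_le_one, sub_add_cancel]

theorem rieszPotential_le_add (F : RSpace n → ℝ≥0∞) (r : ℝ) {S : Set (RSpace n)}
    {x : RSpace n} (hS : ∀ y, ‖x - y‖ ≤ r → y ∈ S) :
    rieszPotential γ F x ≤ rieszPotential γ (S.indicator F) x +
      ∫⁻ y in {y | r ≤ ‖x - y‖}, rieszKernel γ (x - y) * F y := by
  have hm : MeasurableSet {y : RSpace n | r ≤ ‖x - y‖} :=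
    measurableSet_le measurable_const (by fun_prop)
  rw [rieszPotential, ← lintegral_add_compl _ hm, add_comm]
  gcongr
  rw [rieszPotential]
  refine le_trans ?_ (setLIntegral_le_lintegral {y : RSpace n | r ≤ ‖x - y‖}ᶜ _)
  refine setLIntegral_mono' hm.compl fun y hy => ?_
  rw [Set.indicator_of_mem]
  exact hS y (not_le.1 (show ¬ r ≤ ‖x - y‖ from hy)).le

/-- The Riesz potential is bounded between Morrey spaces. -/
theorem exists_emorreyNorm_rieszPotential_le (hn : 0 < n) {p q lam : ℝ} (hγ0 : 0 < γ)
    (hγ : γ < n) (hp : 1 < p) (hq : 1 < q) (hpq : 1 / q = 1 / p - γ / n) (hlam : γ + lam < 0) :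
    ∃ C : ℝ≥0∞, C ≠ ∞ ∧ ∀ F : RSpace n → ℝ≥0∞, Measurable F →
      emorreyNorm q (γ + lam) (rieszPotential γ F) ≤ C * emorreyNorm p lam F := by
  have hn' : (0 : ℝ) < n := by exact_mod_cast hn
  have hp0 : 0 < p := by linarith
  have hq0 : 0 < q := by linarith
  obtain ⟨C₁, hC₁, h₁⟩ := exists_lintegral_rieszPotential_rpow_le hn hγ0 hγ hp hq hpq
  obtain ⟨C₂, hC₂, h₂⟩ := exists_setLIntegral_rieszKernel_le hn hγ hp hlam
  have hexp : ((n : ℝ) + lam * p) * (q / p) = n + (γ + lam) * q := by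
    have h1 : 1 / p = 1 / q + γ / n := by linarith
    have h2 : (n : ℝ) * q * (1 / p) = n + γ * q := by rw [h1]; field_simp
    have h3 : ((n : ℝ) + lam * p) * (q / p) = n * q * (1 / p) + lam * q := by field_simp
    rw [h3, h2]; ring
  set D : ℝ≥0∞ := 2 ^ (q - 1) * (C₁ * ENNReal.ofReal 3 ^ (n + (γ + lam) * q) + C₂ ^ q) with hD
  have h3t : ENNReal.ofReal 3 ^ (n + (γ + lam) * q) ≠ ∞ :=
    ENNReal.rpow_ne_top_of_ne_zero (by simp) (by simp)
  have hDt : D ≠ ∞ := by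
    have := ENNReal.rpow_ne_top_of_nonneg hq0.le hC₂
    finiteness [two_rpow_ne_top (q - 1)]
  refine ⟨D ^ (1 / q), ENNReal.rpow_ne_top_of_nonneg (by positivity) hDt, fun F hF => ?_⟩
  set N := emorreyNorm p lam F with hN
  rw [emorreyNorm_le_iff hn hq0]
  intro a r hr
  rw [ENNReal.mul_rpow_of_nonneg _ _ hq0.le, ← ENNReal.rpow_mul, one_div_mul_cancel hq0.ne',
    ENNReal.rpow_one]
  set R := ENNReal.ofReal r with hR
  have hR0 : R ≠ 0 := by simpa [hR] using hr
  have hRt : R ≠ ∞ := ENNReal.ofReal_ne_top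
  -- The tripled cube contains every point within r of Q. For x in Q, what S omits lies in the tail
  -- ‖x - y‖ ≥ r, which is bounded uniformly in x; on S the Lebesgue estimate applies.
  set S := axisCube (WithLp.toLp 2 fun i => a i - r) (3 * r) with hS
  have hSm : MeasurableSet S := measurableSet_axisCube _ _
  have hG : Measurable (S.indicator F) := hF.indicator hSm
  have hlocal : ∫⁻ x, rieszPotential γ (S.indicator F) x ^ q ≤
      C₁ * ENNReal.ofReal 3 ^ (n + (γ + lam) * q) * (R ^ (n + (γ + lam) * q) * N ^ q) := by
    calc _ ≤ _ := h₁ _ hG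
      _ = C₁ * (∫⁻ x in S, F x ^ p) ^ (q / p) := by
          rw [← lintegral_indicator hSm]
          congr 3; ext x
          by_cases hx : x ∈ S
          · simp [hx]
          · simp [hx, hp0]
      _ ≤ C₁ * (ENNReal.ofReal (3 * r) ^ (n + lam * p) * N ^ p) ^ (q / p) := by
          gcongr
          exact setLIntegral_axisCube_rpow_le hn hp0 (by positivity) F _
      _ = _ := by
          rw [ENNReal.mul_rpow_of_nonneg _ _ (by positivity), ← ENNReal.rpow_mul,
            ← ENNReal.rpow_mul, hexp, mul_div_cancel₀ _ hp0.ne', ENNReal.ofReal_mul (by norm_num),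
            ENNReal.mul_rpow_of_ne_top (by simp) hRt]
          ring
  calc ∫⁻ x in axisCube a r, rieszPotential γ F x ^ q
      ≤ ∫⁻ x in axisCube a r, 2 ^ (q - 1) * (rieszPotential γ (S.indicator F) x ^ q +
          (C₂ * R ^ (γ + lam) * N) ^ q) := by
        refine setLIntegral_mono' (measurableSet_axisCube _ _) fun x hx => ?_
        refine le_trans (ENNReal.rpow_le_rpow ((rieszPotential_le_add F r fun y hy =>
          mem_axisCube_of_norm_sub_le hx hy).trans (add_le_add_right (h₂ F hF x r hr) _)) hq0.le) ?_
        exact ENNReal.rpow_add_le_mul_rpow_add_rpow _ _ hq.le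
    _ = 2 ^ (q - 1) * ((∫⁻ x in axisCube a r, rieszPotential γ (S.indicator F) x ^ q) +
          (C₂ * R ^ (γ + lam) * N) ^ q * R ^ n) := by
        rw [lintegral_const_mul' _ _ (two_rpow_ne_top _), lintegral_add_right _ measurable_const,
          setLIntegral_const, volume_axisCube]
    _ ≤ 2 ^ (q - 1) * (C₁ * ENNReal.ofReal 3 ^ (n + (γ + lam) * q) *
          (R ^ (n + (γ + lam) * q) * N ^ q) + C₂ ^ q * (R ^ (n + (γ + lam) * q) * N ^ q)) := by
        refine mul_le_mul_right (add_le_add ((setLIntegral_le_lintegral _ _).trans hlocal) ?_) _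
        rw [ENNReal.mul_rpow_of_nonneg _ _ hq0.le, ENNReal.mul_rpow_of_nonneg _ _ hq0.le,
          ← ENNReal.rpow_mul, add_comm (n : ℝ), ENNReal.rpow_add _ _ hR0 hRt, ENNReal.rpow_natCast]
        exact le_of_eq (by ring)
    _ = R ^ (n + (γ + lam) * q) * (D * N ^ q) := by rw [hD]; ring

/-- The q-th power has finite integral over each of countably many cubes covering the space. Applied
to the Riesz potential, this gives absolute convergence of the commutator integral almost
everywhere. -/
theorem ae_lt_top_of_emorreyNorm_lt_top (hn : 0 < n) {q lam : ℝ} (hq : 0 < q)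
    {H : RSpace n → ℝ≥0∞} (hH : AEMeasurable H) (h : emorreyNorm q lam H < ∞) :
    ∀ᵐ x, H x < ∞ := by
  rw [← Measure.restrict_univ (μ := (volume : Measure (RSpace n))), ← iUnion_axisCube_eq_univ,
    ae_restrict_iUnion_iff]
  intro m
  have hr : (0 : ℝ) < 2 * (m + 1) := by positivity
  have h1 := setLIntegral_axisCube_rpow_le hn (lam := lam) hq hr H
    (WithLp.toLp 2 fun _ : Fin n => -(m : ℝ))
  have h2 : ENNReal.ofReal (2 * ((m : ℝ) + 1)) ^ ((n : ℝ) + lam * q) * emorreyNorm q lam H ^ q ≠ ∞ :=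
    ENNReal.mul_ne_top (ENNReal.rpow_ne_top_of_ne_zero (by simpa using hr) ENNReal.ofReal_ne_top)
      (ENNReal.rpow_ne_top_of_nonneg hq.le h.ne)
  filter_upwards [ae_lt_top' (hH.restrict.pow_const q) (ne_top_of_le_ne_top h2 h1)] with x hx
  by_contra! h'
  rw [top_le_iff.1 h', ENNReal.top_rpow_of_pos hq] at hx
  exact lt_irrefl _ hx

end HardyLittlewoodSobolev

/-! ### Rough kernels and changes on null sets -/

section Kernel

variable {n : ℕ} {α : ℝ} {Ω Ω' b b' f f' g : RSpace n → ℝ}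

/-- In polar coordinates Lebesgue measure off the origin is a product of σ with a radial measure, so
the cone over a σ-null set is null. Quantifying over u makes the claim vacuous at x = 0, which
cannot be normalized. -/
theorem ae_of_ae_surfaceMeasure (hn : 0 < n) {P : USphere n → Prop}
    (h : ∀ᵐ u ∂(surfaceMeasure n), P u) :
    ∀ᵐ x : RSpace n, ∀ u : USphere n, (u : RSpace n) = ‖x‖⁻¹ • x → P u := by
  have : Nonempty (Fin n) := ⟨⟨0, hn⟩⟩
  have h1 := (Measure.quasiMeasurePreserving_fst.comp
    (Measure.measurePreserving_homeomorphUnitSphereProd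
      (volume : Measure (RSpace n))).quasiMeasurePreserving).ae h
  have hm : MeasurableSet ({0}ᶜ : Set (RSpace n)) := (measurableSet_singleton 0).compl
  have h2 : ∀ᵐ x ∂(Measure.map ((↑) : ({0}ᶜ : Set (RSpace n)) → RSpace n)
      (Measure.comap (↑) (volume : Measure (RSpace n)))),
      ∀ u : USphere n, (u : RSpace n) = ‖x‖⁻¹ • x → P u := by
    rw [(MeasurableEmbedding.subtype_coe hm).ae_map_iff]
    filter_upwards [h1] with x hx u hu
    convert hx
    apply Subtype.ext
    rw [hu, Function.comp_apply, homeomorphUnitSphereProd_apply_fst_coe]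
  rwa [map_comap_subtype_coe hm, restrict_compl_singleton] at h2

theorem HomogeneousDegZero.eq_normalize (h : HomogeneousDegZero Ω) {x : RSpace n} (hx : x ≠ 0) :
    Ω (‖x‖⁻¹ • x) = Ω x :=
  h _ x (by positivity) hx

theorem norm_inv_norm_smul {x : RSpace n} (hx : x ≠ 0) : ‖‖x‖⁻¹ • x‖ = 1 := by
  rw [norm_smul, norm_inv, norm_norm, inv_mul_cancel₀ (norm_ne_zero_iff.2 hx)]

/-- A rough kernel agrees almost everywhere with a measurable bounded function. -/
theorem exists_measurable_bounded_ae_eq (hn : 0 < n) (hΩ_hom : HomogeneousDegZero Ω)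
    (hΩ_bdd : MemLp (onSphere Ω) ∞ (surfaceMeasure n)) :
    ∃ (Ω' : RSpace n → ℝ) (K : ℝ), Measurable Ω' ∧ (∀ x, |Ω' x| ≤ K) ∧ Ω =ᵐ[volume] Ω' := by
  have : Nonempty (Fin n) := ⟨⟨0, hn⟩⟩
  set K := (eLpNorm (onSphere Ω) ∞ (surfaceMeasure n)).toReal with hK
  have hbound : ∀ᵐ u ∂(surfaceMeasure n), |onSphere Ω u| ≤ K := by
    filter_upwards [ae_le_eLpNormEssSup (f := onSphere Ω) (μ := surfaceMeasure n)] with u hu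
    rw [← eLpNorm_exponent_top] at hu
    simpa only [toReal_enorm, Real.norm_eq_abs] using ENNReal.toReal_mono hΩ_bdd.2.ne hu
  set h₀ := hΩ_bdd.1.mk with hh₀
  have hm₀ : Measurable h₀ := hΩ_bdd.1.stronglyMeasurable_mk.measurable
  have hemb : MeasurableEmbedding ((↑) : USphere n → RSpace n) :=
    MeasurableEmbedding.subtype_coe Metric.isClosed_sphere.measurableSet
  set h₁ : RSpace n → ℝ := Function.extend (↑) h₀ 0 with hh₁
  have hm₁ : Measurable h₁ := hemb.measurable_extend hm₀ measurable_zero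
  -- Clamping to [-K, K] makes the bound hold everywhere and changes the function only on a null
  -- set.
  refine ⟨fun x => max (-K) (min K (h₁ (‖x‖⁻¹ • x))), K, ?_, fun x => ?_, ?_⟩
  · exact measurable_const.max (measurable_const.min (hm₁.comp (by fun_prop)))
  · have hK0 : 0 ≤ K := ENNReal.toReal_nonneg
    exact abs_le.2 ⟨le_max_left _ _, max_le (by linarith) (min_le_left _ _)⟩
  · have hne : ∀ᵐ x : RSpace n, x ≠ 0 := by
      simp [ae_iff, measure_singleton]
    filter_upwards [hne, ae_of_ae_surfaceMeasure hn (hbound.and hΩ_bdd.1.ae_eq_mk)] with x hx hu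
    have hus : ‖x‖⁻¹ • x ∈ Metric.sphere (0 : RSpace n) 1 := by
      simpa using norm_inv_norm_smul hx
    obtain ⟨hb, he⟩ := hu ⟨‖x‖⁻¹ • x, hus⟩ rfl
    have h1 : h₁ (‖x‖⁻¹ • x) = h₀ ⟨‖x‖⁻¹ • x, hus⟩ :=
      Subtype.val_injective.extend_apply h₀ 0 (⟨‖x‖⁻¹ • x, hus⟩ : USphere n)
    have h2 : onSphere Ω ⟨‖x‖⁻¹ • x, hus⟩ = Ω x := hΩ_hom.eq_normalize hx
    rw [h1, hh₀, ← he, h2]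
    rw [h2] at hb
    rw [min_eq_right (abs_le.1 hb).2, max_eq_right (abs_le.1 hb).1]

theorem ae_sub_left {P : RSpace n → Prop} (h : ∀ᵐ z, P z) (x : RSpace n) :
    ∀ᵐ y, P (x - y) :=
  (quasiMeasurePreserving_sub_left volume x).ae h

theorem roughIntegrand_congr (hΩ : Ω =ᵐ[volume] Ω') (hf : f =ᵐ[volume] f') (x : RSpace n) :
    roughIntegrand α Ω f x =ᵐ[volume] roughIntegrand α Ω' f' x := by
  filter_upwards [ae_sub_left hΩ x, hf] with y h1 h2
  simp only [roughIntegrand, h1, h2]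

theorem truncOp_congr (hΩ : Ω =ᵐ[volume] Ω') (hf : f =ᵐ[volume] f') (ε : ℝ) (x : RSpace n) :
    truncOp α Ω ε f x = truncOp α Ω' ε f' x :=
  integral_congr_ae (ae_restrict_of_ae (roughIntegrand_congr hΩ hf x))

theorem TruncDefinedAt.congr (hΩ : Ω =ᵐ[volume] Ω') (hf : f =ᵐ[volume] f') {x : RSpace n}
    (h : TruncDefinedAt α Ω f x) : TruncDefinedAt α Ω' f' x := fun ε hε =>
  (h ε hε).congr (ae_restrict_of_ae (roughIntegrand_congr hΩ hf x))

/-- This permits replacing Ω by an everywhere bounded measurable kernel, b by its Hölder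
representative, and f by a measurable one. -/
theorem IsCommutator.congr (hΩ : Ω =ᵐ[volume] Ω') (hb : b =ᵐ[volume] b') (hf : f =ᵐ[volume] f')
    (h : IsCommutator α Ω b f g) : IsCommutator α Ω' b' f' g := by
  have hbf : (fun y => b y * f y) =ᵐ[volume] fun y => b' y * f' y := by
    filter_upwards [hb, hf] with y h1 h2
    rw [h1, h2]
  filter_upwards [h, hb] with x hx hbx
  refine ⟨hx.1.congr hΩ hf, hx.2.1.congr hΩ hbf, hx.2.2.congr fun ε => ?_⟩
  rw [hbx, truncOp_congr hΩ hf, truncOp_congr hΩ hbf]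

end Kernel

/-! ### Hölder symbols give bounded commutators -/

section Sufficiency

variable {n : ℕ} {α β p q lam K L : ℝ} {Ω b f : RSpace n → ℝ}

theorem emorreyNorm_le_const_mul (hn : 0 < n) (hp : 0 < p) {G H : RSpace n → ℝ≥0∞} {c : ℝ≥0∞}
    (hc : c ≠ ∞) (h : ∀ x, G x ≤ c * H x) : emorreyNorm p lam G ≤ c * emorreyNorm p lam H := by
  rw [emorreyNorm_le_iff hn hp]
  intro a r hr
  have hcp : c ^ p ≠ ∞ := ENNReal.rpow_ne_top_of_nonneg hp.le hc
  calc ∫⁻ y in axisCube a r, G y ^ p ≤ ∫⁻ y in axisCube a r, c ^ p * H y ^ p := by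
        refine lintegral_mono fun y => ?_
        rw [← ENNReal.mul_rpow_of_nonneg _ _ hp.le]
        exact ENNReal.rpow_le_rpow (h y) hp.le
    _ = c ^ p * ∫⁻ y in axisCube a r, H y ^ p := lintegral_const_mul' _ _ hcp
    _ ≤ c ^ p * (ENNReal.ofReal r ^ (n + lam * p) * emorreyNorm p lam H ^ p) :=
        mul_le_mul_right (setLIntegral_axisCube_rpow_le hn hp hr H a) _
    _ = _ := by rw [ENNReal.mul_rpow_of_nonneg _ _ hp.le]; ring

theorem emorreyNorm_congr_ae {G H : RSpace n → ℝ≥0∞} (h : G =ᵐ[volume] H) :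
    emorreyNorm p lam G = emorreyNorm p lam H := by
  have : ∀ a r, ∫⁻ y in axisCube a r, G y ^ p = ∫⁻ y in axisCube a r, H y ^ p := fun a r =>
    lintegral_congr_ae (ae_restrict_of_ae (h.mono fun y hy => by simp only [hy]))
  simp only [emorreyNorm, this]

theorem enorm_roughIntegrand_le (hΩ : ∀ x, |Ω x| ≤ K) (x y : RSpace n) :
    ‖roughIntegrand α Ω f x y‖ₑ ≤ ENNReal.ofReal K * (rieszKernel α (x - y) * ‖f y‖ₑ) := by
  have hK : 0 ≤ K := (abs_nonneg _).trans (hΩ 0)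
  rw [roughIntegrand, enorm_mul, ← mul_assoc]
  refine mul_le_mul_left ?_ _
  rw [rieszKernel, ← ENNReal.ofReal_mul hK, Real.enorm_eq_ofReal_abs]
  refine ENNReal.ofReal_le_ofReal ?_
  rw [abs_div, abs_of_nonneg (Real.rpow_nonneg (norm_nonneg _) _), div_eq_mul_inv,
    ← Real.rpow_neg (norm_nonneg _), neg_sub]
  exact mul_le_mul_of_nonneg_right (hΩ _) (Real.rpow_nonneg (norm_nonneg _) _)

/-- The Hölder factor raises the order of the kernel from α to α + β, which is positive; this takes
the place of any cancellation. -/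
theorem enorm_commutator_integrand_le (hΩ : ∀ x, |Ω x| ≤ K)
    (hb : ∀ x y, |b x - b y| ≤ L * ‖x - y‖ ^ β) (hL : 0 ≤ L) (x y : RSpace n) :
    ‖(b x - b y) * roughIntegrand α Ω f x y‖ₑ ≤
      ENNReal.ofReal (L * K) * (rieszKernel (α + β) (x - y) * ‖f y‖ₑ) := by
  rcases eq_or_ne x y with rfl | hxy
  · simp
  have hz : 0 < ‖x - y‖ := norm_pos_iff.2 (sub_ne_zero.2 hxy)
  rw [enorm_mul]
  calc _ ≤ ENNReal.ofReal (L * ‖x - y‖ ^ β) *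
        (ENNReal.ofReal K * (rieszKernel α (x - y) * ‖f y‖ₑ)) := by
        refine mul_le_mul' ?_ (enorm_roughIntegrand_le hΩ x y)
        rw [Real.enorm_eq_ofReal_abs]
        exact ENNReal.ofReal_le_ofReal (hb x y)
    _ = ENNReal.ofReal L * ENNReal.ofReal K *
        (ENNReal.ofReal (‖x - y‖ ^ β * ‖x - y‖ ^ (α - n)) * ‖f y‖ₑ) := by
        rw [ENNReal.ofReal_mul hL, ENNReal.ofReal_mul (by positivity), rieszKernel]; ring
    _ = _ := by
        rw [← Real.rpow_add hz, ENNReal.ofReal_mul hL, rieszKernel]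
        ring_nf

theorem measurable_roughIntegrand_uncurry (hΩ : Measurable Ω) (hf : Measurable f) :
    Measurable fun z : RSpace n × RSpace n => roughIntegrand α Ω f z.1 z.2 := by
  unfold roughIntegrand
  have h1 : Measurable fun z : RSpace n × RSpace n => z.1 - z.2 := measurable_fst.sub measurable_snd
  exact ((hΩ.comp h1).div (h1.norm.pow_const _)).mul (hf.comp measurable_snd)

theorem measurable_roughIntegrand (hΩ : Measurable Ω) (hf : Measurable f) (x : RSpace n) :
    Measurable (roughIntegrand α Ω f x) :=
  (measurable_roughIntegrand_uncurry hΩ hf).comp measurable_prodMk_left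

theorem truncDefinedAt_of_emorreyNorm_lt_top (hn : 0 < n) (hαn : α < n) (hp : 1 < p)
    (hlam : α + lam < 0) (hΩm : Measurable Ω) (hΩ : ∀ x, |Ω x| ≤ K) (hf : Measurable f)
    (hfin : emorreyNorm p lam (fun y => ‖f y‖ₑ) < ∞) (x : RSpace n) :
    TruncDefinedAt α Ω f x := by
  intro ε hε
  obtain ⟨C, hC, h⟩ := exists_setLIntegral_rieszKernel_le hn hαn hp hlam
  refine ⟨(measurable_roughIntegrand hΩm hf x).aestronglyMeasurable, ?_⟩
  have hS : {y : RSpace n | ε < ‖x - y‖} ⊆ {y | ε ≤ ‖x - y‖} := fun y (hy : ε < ‖x - y‖) => hy.le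
  calc _ ≤ ∫⁻ y in {y | ε ≤ ‖x - y‖}, ENNReal.ofReal K * (rieszKernel α (x - y) * ‖f y‖ₑ) :=
        (lintegral_mono_set hS).trans (lintegral_mono fun y => enorm_roughIntegrand_le hΩ x y)
    _ = ENNReal.ofReal K * ∫⁻ y in {y | ε ≤ ‖x - y‖}, rieszKernel α (x - y) * ‖f y‖ₑ :=
        lintegral_const_mul' _ _ ENNReal.ofReal_ne_top
    _ ≤ ENNReal.ofReal K * (C * ENNReal.ofReal ε ^ (α + lam) *
          emorreyNorm p lam fun y => ‖f y‖ₑ) := mul_le_mul_right (h _ hf.enorm x ε hε) _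
    _ < ∞ := by
        have : ENNReal.ofReal ε ^ (α + lam) ≠ ∞ :=
          ENNReal.rpow_ne_top_of_ne_zero (by simpa using hε) ENNReal.ofReal_ne_top
        finiteness

theorem aecover_compl_ball (hn : 0 < n) (x : RSpace n) :
    AECover volume (𝓝[>] (0 : ℝ)) fun ε => {y : RSpace n | ε < ‖x - y‖} where
  ae_eventually_mem := by
    have : Nonempty (Fin n) := ⟨⟨0, hn⟩⟩
    have hne : ∀ᵐ y : RSpace n, y ≠ x := by simp [ae_iff, measure_singleton]
    filter_upwards [hne] with y hy
    have hz : 0 < ‖x - y‖ := norm_pos_iff.2 (sub_ne_zero.2 hy.symm)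
    exact mem_nhdsWithin_of_mem_nhds (Iio_mem_nhds hz)
  measurableSet := fun ε => measurableSet_lt measurable_const (by fun_prop)

theorem continuous_of_abs_sub_le_rpow (hβ : 0 < β)
    (hb : ∀ x y, |b x - b y| ≤ L * ‖x - y‖ ^ β) : Continuous b := by
  refine continuous_iff_continuousAt.2 fun x => ?_
  rw [ContinuousAt, tendsto_iff_dist_tendsto_zero]
  refine squeeze_zero (fun _ => dist_nonneg) (fun y => hb y x) ?_
  have : Continuous fun y : RSpace n => L * ‖y - x‖ ^ β :=
    continuous_const.mul ((by fun_prop : Continuous fun y : RSpace n => ‖y - x‖).rpow_const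
      fun _ => Or.inr hβ.le)
  simpa [hβ.ne'] using this.tendsto x

theorem exists_isCommutator_of_holder (hn : 0 < n) (hβ : 0 < β) (hα0 : 0 ≤ α)
    (hαβ : α + β < n) (hp : 1 < p) (hq : 1 < q) (hpq : 1 / q = 1 / p - (α + β) / n)
    (hlam : α + β + lam < 0) (hΩm : Measurable Ω) (hΩ : ∀ x, |Ω x| ≤ K)
    (hb : ∀ x y, |b x - b y| ≤ L * ‖x - y‖ ^ β) (hL : 0 ≤ L) :
    ∃ C : ℝ≥0∞, C ≠ ∞ ∧ ∀ f : RSpace n → ℝ, Measurable f →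
      emorreyNorm p lam (fun y => ‖f y‖ₑ) < ∞ →
      ∃ g : RSpace n → ℝ, IsCommutator α Ω b f g ∧ AEStronglyMeasurable g ∧
        emorreyNorm q (α + β + lam) (fun y => ‖g y‖ₑ) ≤
          C * emorreyNorm p lam (fun y => ‖f y‖ₑ) := by
  obtain ⟨C, hC, hriesz⟩ :=
    exists_emorreyNorm_rieszPotential_le hn (by linarith) hαβ hp hq hpq hlam
  have hbm : Measurable b := (continuous_of_abs_sub_le_rpow hβ hb).measurable
  refine ⟨ENNReal.ofReal (L * K) * C, by finiteness, fun f hf hfin => ?_⟩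
  have hHm : Measurable (rieszPotential (α + β) fun y => ‖f y‖ₑ) :=
    measurable_rieszPotential hf.enorm
  have hGm : Measurable fun z : RSpace n × RSpace n =>
      (b z.1 - b z.2) * roughIntegrand α Ω f z.1 z.2 :=
    ((hbm.comp measurable_fst).sub (hbm.comp measurable_snd)).mul
      (measurable_roughIntegrand_uncurry hΩm hf)
  have hle : ∀ x, ∫⁻ y, ‖(b x - b y) * roughIntegrand α Ω f x y‖ₑ ≤
      ENNReal.ofReal (L * K) * rieszPotential (α + β) (fun y => ‖f y‖ₑ) x := fun x => by
    rw [rieszPotential, ← lintegral_const_mul' _ _ ENNReal.ofReal_ne_top]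
    exact lintegral_mono fun y => enorm_commutator_integrand_le hΩ hb hL x y
  have hHfin := ae_lt_top_of_emorreyNorm_lt_top hn (by linarith) hHm.aemeasurable
    ((hriesz _ hf.enorm).trans_lt (by finiteness))
  refine ⟨fun x => ∫ y, (b x - b y) * roughIntegrand α Ω f x y, ?_, ?_, ?_⟩
  · filter_upwards [hHfin] with x hx
    have hint : Integrable fun y => (b x - b y) * roughIntegrand α Ω f x y :=
      ⟨(hGm.comp measurable_prodMk_left).aestronglyMeasurable,
        (hle x).trans_lt (by finiteness)⟩
    have hT := truncDefinedAt_of_emorreyNorm_lt_top (α := α) hn (by linarith) hp (by linarith) hΩm hΩ hf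
      hfin x
    have hsub : ∀ y, b x * roughIntegrand α Ω f x y - (b x - b y) * roughIntegrand α Ω f x y =
        roughIntegrand α Ω (fun y => b y * f y) x y := fun y => by
      simp only [roughIntegrand]; ring
    -- b may grow at infinity, so b f is not estimated directly: its truncated integrand is a
    -- difference of two integrable functions.
    have hT' : TruncDefinedAt α Ω (fun y => b y * f y) x := fun ε hε =>
      (((hT ε hε).const_mul (b x)).sub hint.integrableOn).congr
        (Eventually.of_forall hsub)
    refine ⟨hT, hT', ?_⟩
    refine ((aecover_compl_ball hn x).integral_tendsto_of_countably_generated hint).congr' ?_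
    filter_upwards [self_mem_nhdsWithin] with ε hε
    rw [truncOp, truncOp, ← integral_const_mul, ← integral_sub ((hT ε hε).const_mul _) (hT' ε hε)]
    refine integral_congr_ae (Eventually.of_forall fun y => ?_)
    simp only [roughIntegrand]; ring
  · exact hGm.stronglyMeasurable.integral_prod_right'.aestronglyMeasurable
  · calc _ ≤ ENNReal.ofReal (L * K) * emorreyNorm q (α + β + lam)
          (rieszPotential (α + β) fun y => ‖f y‖ₑ) :=
          emorreyNorm_le_const_mul hn (by linarith) ENNReal.ofReal_ne_top fun x =>
            (enorm_integral_le_lintegral_enorm _).trans (hle x)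
      _ ≤ _ := by
          rw [mul_assoc]
          exact mul_le_mul_right (hriesz _ hf.enorm) _

/-- A Lipschitz symbol gives a bounded commutator on Morrey spaces. -/
theorem MemLip.commutatorBounded_morrey (hn : 0 < n) (hβ : 0 < β) (hα0 : 0 ≤ α)
    (hαβ : α + β < n) (hp : 1 < p) (hq : 1 < q) (hpq : 1 / q = 1 / p - (α + β) / n)
    (hlam : α + β + lam < 0) (hΩ_hom : HomogeneousDegZero Ω)
    (hΩ_bdd : MemLp (onSphere Ω) ∞ (surfaceMeasure n)) (hb : MemLip β b) :
    CommutatorBounded α Ω b (morreyNorm p lam) (morreyNorm q (α + β + lam)) := by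
  obtain ⟨Ω', K, hΩm, hK, hΩeq⟩ := exists_measurable_bounded_ae_eq hn hΩ_hom hΩ_bdd
  obtain ⟨b', hbb', L, hL⟩ := hb
  have hL' : ∀ x y, |b' x - b' y| ≤ max L 0 * ‖x - y‖ ^ β := fun x y =>
    (hL x y).trans (mul_le_mul_of_nonneg_right (le_max_left _ _)
      (Real.rpow_nonneg (norm_nonneg _) _))
  obtain ⟨C, hC, h⟩ := exists_isCommutator_of_holder hn hβ hα0 hαβ hp hq hpq hlam hΩm hK hL'
    (le_max_right _ _)
  refine ⟨C.toNNReal, fun f hf hfin => ?_⟩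
  have hmk : (fun y => ‖f y‖ₑ) =ᵐ[volume] fun y => ‖hf.mk f y‖ₑ :=
    hf.ae_eq_mk.mono fun y hy => by simp only [← hy]
  rw [morreyNorm_eq, emorreyNorm_congr_ae hmk] at hfin
  obtain ⟨g, hg, hgm, hgle⟩ := h _ hf.stronglyMeasurable_mk.measurable hfin
  refine ⟨g, hg.congr hΩeq.symm hbb'.symm hf.ae_eq_mk.symm, hgm, ?_⟩
  rw [ENNReal.coe_toNNReal hC, morreyNorm_eq, morreyNorm_eq, emorreyNorm_congr_ae hmk]
  exact hgle

end Sufficiency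

/-! ### Medians -/

section Median

/-- The median is the infimum m of those t whose left half-line carries at least half the mass.
Continuity from above gives the first inequality; below m the mass stays under one half, and
continuity from below passes this to the open half-line, leaving at least half for [m, ∞). -/
theorem exists_median_real (ν : Measure ℝ) [IsFiniteMeasure ν] :
    ∃ m : ℝ, ν Set.univ ≤ 2 * ν (Set.Iic m) ∧ ν Set.univ ≤ 2 * ν (Set.Ici m) := by
  rcases eq_or_ne (ν Set.univ) 0 with h0 | h0
  · exact ⟨0, by simp [h0], by simp [h0]⟩
  have hct : ν Set.univ ≠ ∞ := measure_ne_top _ _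
  have hhalf : ν Set.univ / 2 < ν Set.univ := ENNReal.half_lt_self h0 hct
  set S : Set ℝ := {t | ν Set.univ ≤ 2 * ν (Set.Iic t)} with hS
  have hne : S.Nonempty := by
    obtain ⟨t, ht⟩ := ((tendsto_measure_Iic_atTop ν).eventually (lt_mem_nhds hhalf)).exists
    refine ⟨t, ?_⟩
    have := ENNReal.mul_lt_mul_right (a := 2) (by norm_num) (by norm_num) ht
    rw [ENNReal.mul_div_cancel (by norm_num) (by norm_num)] at this
    exact this.le
  have hup : ∀ t ∈ S, ∀ t', t ≤ t' → t' ∈ S := fun t ht t' htt' =>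
    le_trans ht (mul_le_mul_right (measure_mono (Set.Iic_subset_Iic.2 htt')) _)
  have hbdd : BddBelow S := by
    obtain ⟨t, ht⟩ := ((tendsto_measure_Ici_atBot ν).eventually (lt_mem_nhds hhalf)).exists
    refine ⟨t, fun t' ht' => ?_⟩
    by_contra! hlt
    have h2 := ENNReal.mul_lt_mul_right (a := 2) (by norm_num) (by norm_num) ht
    rw [ENNReal.mul_div_cancel (by norm_num) (by norm_num)] at h2
    have h3 : ν (Set.Iic t') + ν (Set.Ici t) ≤ ν Set.univ := by
      rw [← measure_union (by simp only [Set.disjoint_left, Set.mem_Iic, Set.mem_Ici]; grind)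
        measurableSet_Ici]
      exact measure_mono (Set.subset_univ _)
    have h4 := ENNReal.add_lt_add_of_le_of_lt hct ht' h2
    rw [← mul_add, ← two_mul] at h4
    exact absurd (h4.trans_le (mul_le_mul_right h3 _)) (lt_irrefl _)
  refine ⟨sInf S, ?_, ?_⟩
  · obtain ⟨u, hu_anti, hu, hlim⟩ := exists_seq_strictAnti_tendsto (sInf S)
    have hI : Set.Iic (sInf S) = ⋂ k, Set.Iic (u k) := by
      ext y
      simp only [Set.mem_Iic, Set.mem_iInter]
      exact ⟨fun h k => h.trans (hu k).le, fun h => ge_of_tendsto' hlim h⟩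
    rw [hI]
    have hanti : Antitone fun k => Set.Iic (u k) := fun i j hij =>
      Set.Iic_subset_Iic.2 (hu_anti.antitone hij)
    have ht := tendsto_measure_iInter_atTop (μ := ν)
      (fun k => (measurableSet_Iic (a := u k)).nullMeasurableSet) hanti ⟨0, measure_ne_top _ _⟩
    refine ge_of_tendsto' (ENNReal.Tendsto.const_mul ht (Or.inr (by norm_num))) fun k => ?_
    obtain ⟨t, htS, htk⟩ := exists_lt_of_csInf_lt hne (hu k)
    exact hup t htS _ htk.le
  · by_contra! hlt
    obtain ⟨u, hu_mono, hu, hlim⟩ := exists_seq_strictMono_tendsto (sInf S)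
    have hI : Set.Iio (sInf S) = ⋃ k, Set.Iic (u k) := by
      ext y
      simp only [Set.mem_Iio, Set.mem_iUnion, Set.mem_Iic]
      refine ⟨fun h => ?_, fun ⟨k, hk⟩ => hk.trans_lt (hu k)⟩
      obtain ⟨k, hk⟩ := (hlim.eventually (lt_mem_nhds h)).exists
      exact ⟨k, hk.le⟩
    have ht := tendsto_measure_iUnion_atTop (μ := ν) (s := fun k => Set.Iic (u k))
      fun i j hij => Set.Iic_subset_Iic.2 (hu_mono.monotone hij)
    have hle : 2 * ν (Set.Iio (sInf S)) ≤ ν Set.univ := by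
      rw [hI]
      refine le_of_tendsto' (ENNReal.Tendsto.const_mul ht (Or.inr (by norm_num))) fun k => ?_
      by_contra! hk
      exact absurd (csInf_le hbdd (show u k ∈ S from hk.le)) (not_le.2 (hu k))
    have hsum : ν Set.univ = ν (Set.Iio (sInf S)) + ν (Set.Ici (sInf S)) := by
      rw [← measure_union (by simp [Set.disjoint_left]) measurableSet_Ici, Set.Iio_union_Ici]
    have : 2 * ν (Set.Iio (sInf S)) + 2 * ν (Set.Ici (sInf S)) < ν Set.univ + ν Set.univ :=
      ENNReal.add_lt_add_of_le_of_lt (by finiteness) hle hlt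
    rw [← mul_add, ← hsum, two_mul] at this
    exact lt_irrefl _ this

theorem exists_median {X : Type*} [MeasurableSpace X] (μ : Measure X) [IsFiniteMeasure μ]
    {b : X → ℝ} (hb : Measurable b) :
    ∃ m : ℝ, μ Set.univ ≤ 2 * μ {x | b x ≤ m} ∧ μ Set.univ ≤ 2 * μ {x | m ≤ b x} := by
  obtain ⟨m, h1, h2⟩ := exists_median_real (μ.map b)
  rw [Measure.map_apply hb .univ, Measure.map_apply hb measurableSet_Iic] at h1
  rw [Measure.map_apply hb .univ, Measure.map_apply hb measurableSet_Ici] at h2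
  exact ⟨m, h1, h2⟩

end Median

/-! ### Campanato's criterion for Hölder continuity -/

section Campanato

variable {n : ℕ} {β : ℝ} {b : RSpace n → ℝ}

theorem norm_sub_rpow_le (hβ0 : 0 < β) (hβ1 : β < 1) (x y z : RSpace n) :
    ‖x - z‖ ^ β ≤ ‖x - y‖ ^ β + ‖y - z‖ ^ β :=
  (Real.rpow_le_rpow (norm_nonneg _) (norm_sub_le_norm_sub_add_norm_sub x y z) hβ0.le).trans
    (Real.rpow_add_le_add_rpow (norm_nonneg _) (norm_nonneg _) hβ0.le hβ1.le)

/-- A McShane type extension of a Hölder function. -/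
theorem exists_holder_extension (hβ0 : 0 < β) (hβ1 : β < 1) {C : ℝ} (hC : 0 ≤ C)
    {S : Set (RSpace n)} (hS : S.Nonempty) (h : ∀ x ∈ S, ∀ y ∈ S, b x - b y ≤ C * ‖x - y‖ ^ β) :
    ∃ g : RSpace n → ℝ, (∀ x ∈ S, g x = b x) ∧ ∀ x y, |g x - g y| ≤ C * ‖x - y‖ ^ β := by
  have : Nonempty S := hS.to_subtype
  -- For 0 < β < 1 the function ‖x - y‖^β is itself a metric, so McShane's infimum formula works as
  -- for Lipschitz functions.
  have htri : ∀ x y z : RSpace n, C * ‖x - z‖ ^ β ≤ C * ‖x - y‖ ^ β + C * ‖y - z‖ ^ β :=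
    fun x y z => by
      rw [← mul_add]; exact mul_le_mul_of_nonneg_left (norm_sub_rpow_le hβ0 hβ1 x y z) hC
  have hlow : ∀ x : RSpace n, ∀ y₀ ∈ S, ∀ y : S,
      b y₀ - C * ‖x - y₀‖ ^ β ≤ b y + C * ‖x - y‖ ^ β := fun x y₀ hy₀ y => by
    have h1 := h y₀ hy₀ y y.2
    have h2 := htri y₀ x y
    rw [norm_sub_rev y₀ x] at h2
    linarith
  have hbdd : ∀ x : RSpace n, BddBelow (Set.range fun y : S => b y + C * ‖x - y‖ ^ β) := fun x => by
    obtain ⟨y₀, hy₀⟩ := hS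
    exact ⟨_, Set.forall_mem_range.2 fun y => hlow x y₀ hy₀ y⟩
  set g : RSpace n → ℝ := fun x => ⨅ y : S, (b y + C * ‖x - y‖ ^ β) with hg
  have hle : ∀ x y : RSpace n, g x - g y ≤ C * ‖x - y‖ ^ β := fun x y => by
    rw [sub_le_iff_le_add, ← sub_le_iff_le_add']
    refine le_ciInf fun z => ?_
    have h1 : g x ≤ b z + C * ‖x - z‖ ^ β := ciInf_le (hbdd x) z
    have h2 := htri x y z
    linarith
  refine ⟨g, fun x hx => le_antisymm ?_ (le_ciInf fun y => ?_), fun x y => abs_le.2 ⟨?_, hle x y⟩⟩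
  · have h1 : g x ≤ b x + C * ‖x - x‖ ^ β := ciInf_le (hbdd x) ⟨x, hx⟩
    simpa [hβ0.ne'] using h1
  · simpa [hβ0.ne'] using hlow x x hx y
  · have := hle y x
    rw [norm_sub_rev] at this
    linarith

/-- The average of b - m over the small ball is at most the integral of |b - m| over the large one
divided by the small volume; comparable radii cost only a constant. It serves both to pass from a
ball to its half and to compare balls with different centres. -/
theorem abs_average_sub_le (hn : 0 < n) (hβ0 : 0 < β) (hb : LocallyIntegrable b) {D : ℝ}
    (hD : 0 ≤ D) {x z : RSpace n} {r R m : ℝ} (hr : 0 < r) (hR0 : 0 < R) (hR : R ≤ 4 * r)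
    (hsub : Metric.closedBall x r ⊆ Metric.closedBall z R)
    (hm : ∫⁻ y in Metric.closedBall z R, ‖b y - m‖ₑ ≤
      ENNReal.ofReal D * ENNReal.ofReal R ^ (n + β)) :
    |(⨍ y in Metric.closedBall x r, b y) - m| ≤
      D * 4 ^ (n + β) / volume.real (Metric.closedBall (0 : RSpace n) 1) * r ^ β := by
  have hn' : (0 : ℝ) < n := by exact_mod_cast hn
  set B := Metric.closedBall x r
  set v := volume.real (Metric.closedBall (0 : RSpace n) 1)
  have hv : 0 < v := ENNReal.toReal_pos (volume_closedBall_ne_zero _ one_pos)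
    (volume_closedBall_ne_top _ _)
  have hB : volume.real B = r ^ n * v := by
    have := Measure.addHaar_closedBall_mul (volume : Measure (RSpace n)) x hr.le (zero_le_one' ℝ)
    rw [mul_one] at this
    rw [measureReal_def, this, finrank_euclideanSpace_fin, ENNReal.toReal_mul,
      ENNReal.toReal_ofReal (by positivity)]
    rfl
  have hBpos : 0 < volume.real B := by rw [hB]; positivity
  have hint : IntegrableOn b B := hb.integrableOn_isCompact (isCompact_closedBall _ _)
  have hfin : volume B ≠ ∞ := volume_closedBall_ne_top _ _
  have hintm : IntegrableOn (fun y => b y - m) B := hint.sub (integrableOn_const hfin)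
  have h1 : (⨍ y in B, b y) - m = (volume.real B)⁻¹ * ∫ y in B, (b y - m) := by
    rw [setAverage_eq, integral_sub hint (integrableOn_const hfin), setIntegral_const, smul_eq_mul,
      smul_eq_mul]
    field_simp
  have h2 : |∫ y in B, (b y - m)| ≤ D * R ^ (n + β) := by
    rw [← Real.norm_eq_abs]
    refine (norm_integral_le_integral_norm _).trans ?_
    rw [integral_norm_eq_lintegral_enorm hintm.1]
    refine ENNReal.toReal_le_of_le_ofReal (by positivity) ?_
    refine (lintegral_mono_set hsub).trans (hm.trans_eq ?_)
    rw [ENNReal.ofReal_mul hD, ENNReal.ofReal_rpow_of_pos hR0]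
  rw [h1, abs_mul, abs_of_pos (inv_pos.2 hBpos), inv_mul_le_iff₀ hBpos, hB]
  refine h2.trans ?_
  calc D * R ^ ((n : ℝ) + β) ≤ D * (4 * r) ^ ((n : ℝ) + β) := by gcongr
    _ = _ := by
      rw [Real.mul_rpow (by norm_num) hr.le, Real.rpow_add hr, Real.rpow_natCast]
      field_simp

/-- Campanato's characterization of Hölder continuity (one direction). -/
theorem memLip_of_campanato (hn : 0 < n) (hβ0 : 0 < β) (hβ1 : β < 1) (hb : LocallyIntegrable b)
    {D : ℝ≥0∞} (hD : D ≠ ∞) (h : ∀ (x : RSpace n) (r : ℝ), 0 < r → ∃ m : ℝ,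
      ∫⁻ y in Metric.closedBall x r, ‖b y - m‖ₑ ≤ D * ENNReal.ofReal r ^ (n + β)) :
    MemLip β b := by
  obtain ⟨D, rfl⟩ : ∃ D' : ℝ≥0, D = D' := ⟨D.toNNReal, (ENNReal.coe_toNNReal hD).symm⟩
  rw [← ENNReal.ofReal_coe_nnreal] at h
  choose! m hm using h
  set C₁ := (D : ℝ) * 4 ^ (n + β) / volume.real (Metric.closedBall (0 : RSpace n) 1) with hC₁
  have hC₁0 : 0 ≤ C₁ := by positivity
  set avg : RSpace n → ℝ → ℝ := fun x r => ⨍ y in Metric.closedBall x r, b y with havg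
  have hA : ∀ (x z : RSpace n) (r R : ℝ), 0 < r → 0 < R → R ≤ 4 * r →
      Metric.closedBall x r ⊆ Metric.closedBall z R → |avg x r - m z R| ≤ C₁ * r ^ β :=
    fun x z r R hr hR0 hR hsub =>
      abs_average_sub_le hn hβ0 hb D.2 hr hR0 hR hsub (hm z R hR0)
  set ρ : ℝ := (1 / 2) ^ β with hρ
  have hρ1 : ρ < 1 := Real.rpow_lt_one (by norm_num) (by norm_num) hβ0
  -- By Lebesgue differentiation S has full measure. For x in S the halving differences telescope to
  -- a geometric series of ratio 2^(-β), bounding the distance from the average to b(x).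
  set S : Set (RSpace n) := {x | ∀ r : ℝ, 0 < r →
    Tendsto (fun k : ℕ => avg x (r * (1 / 2) ^ k)) atTop (𝓝 (b x))} with hS
  have hSae : ∀ᵐ x, x ∈ S := by
    filter_upwards [IsUnifLocDoublingMeasure.ae_tendsto_average volume hb 1] with x hx r hr
    refine hx (fun _ => x) (fun k : ℕ => r * (1 / 2) ^ k) ?_ ?_
    · refine tendsto_nhdsWithin_iff.2 ⟨?_, Eventually.of_forall fun k => by
        simp only [Set.mem_Ioi]; positivity⟩
      simpa using (tendsto_pow_atTop_nhds_zero_of_lt_one (r := (1 / 2 : ℝ)) (by norm_num)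
        (by norm_num)).const_mul r
    · exact Eventually.of_forall fun k => Metric.mem_closedBall_self (by positivity)
  have hpt : ∀ x ∈ S, ∀ r : ℝ, 0 < r → |avg x r - b x| ≤ 2 * C₁ * r ^ β / (1 - ρ) := by
    intro x hx r hr
    have hgeo : ∀ k : ℕ, dist (avg x (r * (1 / 2) ^ k)) (avg x (r * (1 / 2) ^ (k + 1))) ≤
        2 * C₁ * r ^ β * ρ ^ k := by
      intro k
      set s := r * (1 / 2 : ℝ) ^ k with hs
      have hs0 : 0 < s := by positivity
      have e : r * (1 / 2 : ℝ) ^ (k + 1) = s / 2 := by rw [hs]; ring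
      have h1 := hA x x s s hs0 hs0 (by linarith) subset_rfl
      have h2 := hA x x (s / 2) s (by positivity) hs0 (by linarith)
        (Metric.closedBall_subset_closedBall (by linarith))
      have h3 : (s / 2) ^ β ≤ s ^ β := Real.rpow_le_rpow (by positivity) (by linarith) hβ0.le
      have h4 : s ^ β = r ^ β * ρ ^ k := by
        rw [hs, Real.mul_rpow hr.le (by positivity), hρ, ← Real.rpow_natCast, ← Real.rpow_natCast,
          ← Real.rpow_mul (by norm_num), ← Real.rpow_mul (by norm_num), mul_comm β]
      have h5 : C₁ * (s / 2) ^ β ≤ C₁ * s ^ β := mul_le_mul_of_nonneg_left h3 hC₁0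
      rw [e, Real.dist_eq, mul_assoc, ← h4]
      have := abs_sub_le (avg x s) (m x s) (avg x (s / 2))
      rw [abs_sub_comm (m x s)] at this
      linarith
    have := dist_le_of_le_geometric_of_tendsto₀ ρ _ hρ1 hgeo (hx r hr)
    simpa [Real.dist_eq] using this
  set C := 2 * (2 * C₁ / (1 - ρ)) + 2 * C₁ with hC
  have h1ρ : 0 < 1 - ρ := by linarith
  have hC0 : 0 ≤ C := by positivity
  have hhol : ∀ x ∈ S, ∀ z ∈ S, b x - b z ≤ C * ‖x - z‖ ^ β := by
    intro x hx z hz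
    rcases eq_or_ne x z with rfl | hxz
    · simp [hβ0.ne']
    set r := ‖x - z‖ with hr
    have hr0 : 0 < r := norm_pos_iff.2 (sub_ne_zero.2 hxz)
    have h1 := abs_le.1 (hpt x hx r hr0)
    have h2 := abs_le.1 (hpt z hz r hr0)
    -- The ball about z of radius 2‖x - z‖ contains the balls of radius ‖x - z‖ about x and z, so
    -- both averages are compared with the same constant.
    have h3 := abs_le.1 (hA x z r (2 * r) hr0 (by positivity) (by linarith)
      (Metric.closedBall_subset_closedBall' (by rw [dist_eq_norm]; linarith)))
    have h4 := abs_le.1 (hA z z r (2 * r) hr0 (by positivity) (by linarith)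
      (Metric.closedBall_subset_closedBall (by linarith)))
    have h5 : C * r ^ β = 2 * (2 * C₁ * r ^ β / (1 - ρ)) + 2 * (C₁ * r ^ β) := by rw [hC]; ring
    rw [h5]
    linarith [h1.1, h2.2, h3.2, h4.1]
  obtain ⟨g, hgS, hg⟩ := exists_holder_extension hβ0 hβ1 hC0 hSae.exists hhol
  exact ⟨g, hSae.mono fun x hx => (hgS x hx).symm, C, hg⟩

end Campanato

/-! ### Bounded commutators force Hölder symbols -/

section Necessity

variable {n : ℕ} {α β p q lam : ℝ} {Ω b : RSpace n → ℝ}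

theorem exists_cone_of_isOpen (hn : 0 < n) (hΩ_hom : HomogeneousDegZero Ω)
    {U : Set (USphere n)} (hU : IsOpen U) {u₀ : USphere n} (hu₀ : u₀ ∈ U) {c s : ℝ}
    (h : ∀ᵐ u ∂(surfaceMeasure n), u ∈ U → c ≤ s * onSphere Ω u) :
    ∃ δ : ℝ, 0 < δ ∧ ∀ᵐ z : RSpace n, z ≠ 0 → ‖‖z‖⁻¹ • z - u₀‖ < δ → c ≤ s * Ω z := by
  obtain ⟨δ, hδ, hball⟩ := Metric.isOpen_iff.1 hU u₀ hu₀
  refine ⟨δ, hδ, ?_⟩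
  filter_upwards [ae_of_ae_surfaceMeasure hn h] with z hz hz0 hzδ
  have hzs : ‖z‖⁻¹ • z ∈ Metric.sphere (0 : RSpace n) 1 := by
    simpa using norm_inv_norm_smul hz0
  have h1 := hz ⟨‖z‖⁻¹ • z, hzs⟩ rfl (hball (by
    rw [Metric.mem_ball, Subtype.dist_eq, dist_eq_norm]; exact hzδ))
  rwa [onSphere, hΩ_hom.eq_normalize hz0] at h1

/-- The kernel has a sign and is bounded away from zero on an open cone. -/
theorem exists_cone (hn : 0 < n) (hΩ_hom : HomogeneousDegZero Ω)
    (hΩ_ne : ¬ onSphere Ω =ᵐ[surfaceMeasure n] 0)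
    (hΩ_local : LocallyOneSigned Ω ∨ Continuous (onSphere Ω)) :
    ∃ (u₀ : RSpace n) (δ c s : ℝ), ‖u₀‖ = 1 ∧ 0 < δ ∧ 0 < c ∧ |s| = 1 ∧
      ∀ᵐ z : RSpace n, z ≠ 0 → ‖‖z‖⁻¹ • z - u₀‖ < δ → c ≤ s * Ω z := by
  suffices H : ∃ (U : Set (USphere n)) (u₀ : USphere n) (c s : ℝ), IsOpen U ∧ u₀ ∈ U ∧ 0 < c ∧
      |s| = 1 ∧ ∀ᵐ u ∂(surfaceMeasure n), u ∈ U → c ≤ s * onSphere Ω u by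
    obtain ⟨U, u₀, c, s, hU, hu₀, hc, hs, h⟩ := H
    obtain ⟨δ, hδ, h'⟩ := exists_cone_of_isOpen hn hΩ_hom hU hu₀ h
    exact ⟨u₀, δ, c, s, by simp, hδ, hc, hs, h'⟩
  rcases hΩ_local with ⟨U, hU, ⟨u₀, hu₀⟩, c, C, -, hc | hC, h⟩ | hcont
  · exact ⟨U, u₀, c, 1, hU, hu₀, hc, by simp, h.mono fun u hu huU => by linarith [(hu huU).1]⟩
  · exact ⟨U, u₀, -C, -1, hU, hu₀, by linarith, by simp,
      h.mono fun u hu huU => by linarith [(hu huU).2]⟩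
  · obtain ⟨u₀, hu₀⟩ : ∃ u₀, onSphere Ω u₀ ≠ 0 := by
      by_contra! h0
      exact hΩ_ne (Eventually.of_forall h0)
    obtain ⟨s, hs, hsu⟩ : ∃ s : ℝ, |s| = 1 ∧ s * onSphere Ω u₀ = |onSphere Ω u₀| := by
      rcases abs_cases (onSphere Ω u₀) with h | h
      · exact ⟨1, by simp, by rw [h.1, one_mul]⟩
      · exact ⟨-1, by simp, by rw [h.1, neg_one_mul]⟩
    have hpos : 0 < |onSphere Ω u₀| := abs_pos.2 hu₀
    refine ⟨{u | |onSphere Ω u₀| / 2 < s * onSphere Ω u}, u₀, |onSphere Ω u₀| / 2, s,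
      isOpen_lt continuous_const (continuous_const.mul hcont), ?_, by linarith, hs,
      Eventually.of_forall fun u hu => le_of_lt hu⟩
    change _ < s * onSphere Ω u₀
    rw [hsu]; linarith

/-- Differences of points of two well separated balls point in a prescribed direction. -/
theorem cone_geometry {u₀ x₀ x y : RSpace n} {δ r : ℝ} (hu₀ : ‖u₀‖ = 1) (hδ : 0 < δ) (hr : 0 < r)
    (hx : x ∈ Metric.closedBall x₀ r)
    (hy : y ∈ Metric.closedBall (x₀ - ((3 + 4 / δ) * r) • u₀) r) :
    r < ‖x - y‖ ∧ ‖x - y‖ ≤ (5 + 4 / δ) * r ∧ ‖‖x - y‖⁻¹ • (x - y) - u₀‖ < δ := by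
  -- Since z = x - y lies within 2r of A r u₀, its norm is at least (A - 2) r = (1 + 4/δ) r, while
  -- ‖z - ‖z‖ u₀‖ ≤ 4r. Dividing, the direction of z is off by less than δ.
  set A := 3 + 4 / δ with hA
  have h4 : 0 < 4 / δ := by positivity
  rw [mem_closedBall_iff_norm] at hx hy
  set z := x - y with hz
  have hw : ‖z - (A * r) • u₀‖ ≤ 2 * r := by
    have : z - (A * r) • u₀ = (x - x₀) - (y - (x₀ - (A * r) • u₀)) := by rw [hz]; abel
    rw [this]
    exact (norm_sub_le _ _).trans (by linarith)
  have hAr : ‖(A * r) • u₀‖ = A * r := by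
    rw [norm_smul, hu₀, mul_one, Real.norm_of_nonneg (by positivity)]
  have habs := abs_le.1 ((abs_norm_sub_norm_le z ((A * r) • u₀)).trans hw)
  rw [hAr] at habs
  have hlow : (1 + 4 / δ) * r ≤ ‖z‖ := by have := habs.1; rw [hA] at this; linarith
  have hr' : r < (1 + 4 / δ) * r := by nlinarith
  have hz0 : 0 < ‖z‖ := by linarith
  refine ⟨by linarith, by have := habs.2; rw [hA] at this; linarith, ?_⟩
  have h1 : ‖z‖ * ‖‖z‖⁻¹ • z - u₀‖ ≤ 4 * r := by
    have e : ‖z‖ * ‖‖z‖⁻¹ • z - u₀‖ = ‖z - ‖z‖ • u₀‖ := by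
      conv_lhs => rw [← norm_norm z, ← norm_smul, smul_sub, smul_smul, norm_norm,
        mul_inv_cancel₀ hz0.ne', one_smul]
    have e2 : z - ‖z‖ • u₀ = (z - (A * r) • u₀) + (A * r - ‖z‖) • u₀ := by
      rw [sub_smul]; abel
    rw [e, e2]
    refine (norm_add_le _ _).trans ?_
    rw [norm_smul, hu₀, mul_one, Real.norm_eq_abs]
    have : |A * r - ‖z‖| ≤ 2 * r := abs_le.2 ⟨by linarith [habs.2], by linarith [habs.1]⟩
    linarith
  by_contra! hge
  have h2 : (1 + 4 / δ) * r * δ ≤ 4 * r :=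
    (mul_le_mul hlow hge hδ.le hz0.le).trans h1
  have h3 : (1 + 4 / δ) * r * δ = r * δ + 4 * r := by field_simp
  have := mul_pos hr hδ
  linarith

/-- Testing the commutator on the indicator of a set `E` where `b` lies on one side of `m`. -/
theorem ae_le_abs_commutator_indicator (hαn : α < n) {u₀ x₀ : RSpace n} {δ c s r m τ : ℝ}
    (hu₀ : ‖u₀‖ = 1) (hδ : 0 < δ) (hc : 0 < c) (hs : |s| = 1) (hr : 0 < r) (hτ : |τ| = 1)
    (hcone : ∀ᵐ z : RSpace n, z ≠ 0 → ‖‖z‖⁻¹ • z - u₀‖ < δ → c ≤ s * Ω z)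
    {E : Set (RSpace n)} (hE : MeasurableSet E)
    (hEP : E ⊆ Metric.closedBall (x₀ - ((3 + 4 / δ) * r) • u₀) r)
    (hEb : ∀ y ∈ E, τ * (b y - m) ≤ 0) {g : RSpace n → ℝ}
    (hg : IsCommutator α Ω b (E.indicator 1) g) :
    ∀ᵐ x : RSpace n, x ∈ Metric.closedBall x₀ r →
      c * ((5 + 4 / δ) * r) ^ (α - n) * volume.real E * (τ * (b x - m)) ≤ |g x| := by
  have hEfin : volume E ≠ ∞ :=
    ((measure_mono hEP).trans_lt (volume_closedBall_ne_top _ _).lt_top).ne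
  filter_upwards [hg] with x ⟨hT, hT', hlim⟩ hx
  rcases le_or_gt (τ * (b x - m)) 0 with hneg | hpos
  · refine le_trans ?_ (abs_nonneg _)
    exact mul_nonpos_of_nonneg_of_nonpos (by positivity) hneg
  refine ge_of_tendsto hlim.abs ?_
  -- For ε < r the truncation does not touch E, whose points are farther than r from x, so the lower
  -- bound is the same for all such ε.
  filter_upwards [Ioo_mem_nhdsGT hr] with ε hε
  set S := {y : RSpace n | ε < ‖x - y‖} with hS
  have hSm : MeasurableSet S := measurableSet_lt measurable_const (by fun_prop)
  have hES : E ⊆ S := fun y hy => hε.2.trans (cone_geometry hu₀ hδ hr hx (hEP hy)).1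
  -- On E the integrand, multiplied by the signs s and τ, is at least κ: the kernel contributes the
  -- first two factors, and b(y) lying on the far side of m contributes the last.
  set κ := c * ((5 + 4 / δ) * r) ^ (α - n) * (τ * (b x - m)) with hκ
  have hI := hT ε hε.1
  have hI' := hT' ε hε.1
  have hint : IntegrableOn (fun y => s * τ * (b x * roughIntegrand α Ω (E.indicator 1) x y -
      roughIntegrand α Ω (fun y => b y * E.indicator 1 y) x y)) S :=
    ((hI.const_mul _).sub hI').const_mul _
  have hle : ∫ y in S, E.indicator (fun _ => κ) y ≤ ∫ y in S, s * τ * (b x *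
      roughIntegrand α Ω (E.indicator 1) x y -
      roughIntegrand α Ω (fun y => b y * E.indicator 1 y) x y) := by
    refine integral_mono_ae ?_ hint (ae_restrict_of_ae ?_)
    · exact ((integrable_indicator_iff hE).2 (integrableOn_const hEfin)).integrableOn
    · filter_upwards [ae_sub_left hcone x] with y hy
      by_cases hyE : y ∈ E
      · obtain ⟨h1, h2, h3⟩ := cone_geometry hu₀ hδ hr hx (hEP hyE)
        have hz0 : 0 < ‖x - y‖ := hr.trans h1
        have hΩ := hy (norm_pos_iff.1 hz0) h3
        have hpow : ((5 + 4 / δ) * r) ^ (α - n) ≤ ‖x - y‖ ^ (α - n) :=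
          Real.rpow_le_rpow_of_nonpos hz0 h2 (by linarith)
        have hb1 : τ * (b x - m) ≤ τ * (b x - b y) := by linarith [hEb y hyE]
        simp only [roughIntegrand, Set.indicator_of_mem hyE, Pi.one_apply, mul_one, hκ]
        have e : s * τ * (b x * (Ω (x - y) / ‖x - y‖ ^ ((n : ℝ) - α)) -
            Ω (x - y) / ‖x - y‖ ^ ((n : ℝ) - α) * b y) =
            (s * Ω (x - y)) * ‖x - y‖ ^ (α - n) * (τ * (b x - b y)) := by
          rw [show α - n = -((n : ℝ) - α) by ring, Real.rpow_neg hz0.le]; ring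
        have hsΩ : 0 ≤ s * Ω (x - y) := hc.le.trans hΩ
        rw [e]
        gcongr
      · simp [roughIntegrand, Set.indicator_of_notMem hyE]
  have hκE : ∫ y in S, E.indicator (fun _ => κ) y = volume.real E * κ := by
    rw [setIntegral_indicator hE, Set.inter_eq_self_of_subset_right hES, setIntegral_const,
      smul_eq_mul]
  have hD : ∫ y in S, s * τ * (b x * roughIntegrand α Ω (E.indicator 1) x y -
      roughIntegrand α Ω (fun y => b y * E.indicator 1 y) x y) =
      s * τ * (b x * truncOp α Ω ε (E.indicator 1) x -
        truncOp α Ω ε (fun y => b y * E.indicator 1 y) x) := by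
    rw [integral_const_mul, integral_sub (hI.const_mul _) hI', integral_const_mul]
    rfl
  rw [hκE, hD] at hle
  calc _ = volume.real E * κ := by rw [hκ]; ring
    _ ≤ _ := hle.trans (le_abs_self _)
    _ = _ := by rw [abs_mul, abs_mul, hs, hτ, one_mul, one_mul]

/-- Cubes of side ρ ≤ 2r use |E ∩ Q| ≤ |Q| and λ < 0. Larger ones use |E| ≤ (2r)^n, together with
-n/p ≤ λ, which makes ρ^(n + λp) nondecreasing. -/
theorem emorreyNorm_indicator_le (hn : 0 < n) (hp : 1 < p) (hlam_lower : -(n : ℝ) / p ≤ lam)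
    (hlam_neg : lam < 0) {E : Set (RSpace n)} (hE : MeasurableSet E) {y₀ : RSpace n} {r : ℝ}
    (hr : 0 < r) (hEP : E ⊆ Metric.closedBall y₀ r) :
    emorreyNorm p lam (fun y => ‖E.indicator (1 : RSpace n → ℝ) y‖ₑ) ≤
      ENNReal.ofReal (2 * r) ^ (-lam) := by
  have hp0 : 0 < p := by linarith
  rw [emorreyNorm_le_iff hn hp0]
  intro a ρ hρ
  have hR0 : ENNReal.ofReal (2 * r) ≠ 0 := by simpa using hr
  have hρ0 : ENNReal.ofReal ρ ≠ 0 := by simpa using hρ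
  have e : ∫⁻ y in axisCube a ρ, ‖E.indicator (1 : RSpace n → ℝ) y‖ₑ ^ p =
      volume (E ∩ axisCube a ρ) := by
    rw [← Measure.restrict_apply hE, ← lintegral_indicator_one hE]
    congr 1; ext y
    by_cases hy : y ∈ E
    · simp [hy]
    · simp [hy, hp0]
  have hlp : 0 ≤ -lam * p := mul_nonneg (by linarith) hp0.le
  have hlp' : 0 ≤ n + lam * p := by
    have := (div_le_iff₀ hp0).1 hlam_lower
    linarith
  rw [e, ← ENNReal.rpow_mul]
  rcases le_total ρ (2 * r) with h | h
  · calc volume (E ∩ axisCube a ρ) ≤ volume (axisCube a ρ) := measure_mono Set.inter_subset_right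
      _ = ENNReal.ofReal ρ ^ (n + lam * p) * ENNReal.ofReal ρ ^ (-lam * p) := by
        rw [volume_axisCube, ← ENNReal.rpow_natCast, ← ENNReal.rpow_add _ _ hρ0 (by simp)]
        congr 1; ring
      _ ≤ _ := mul_le_mul_right (ENNReal.rpow_le_rpow (ENNReal.ofReal_le_ofReal h) hlp) _
  · calc volume (E ∩ axisCube a ρ)
        ≤ volume (axisCube (WithLp.toLp 2 fun i => y₀ i - r) (2 * r)) := measure_mono
          (Set.inter_subset_left.trans (hEP.trans (closedBall_subset_axisCube _ _)))
      _ = ENNReal.ofReal (2 * r) ^ (n + lam * p) * ENNReal.ofReal (2 * r) ^ (-lam * p) := by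
        rw [volume_axisCube, ← ENNReal.rpow_natCast,
          ← ENNReal.rpow_add _ _ hR0 ENNReal.ofReal_ne_top]
        congr 1; ring
      _ ≤ _ := mul_le_mul_left (ENNReal.rpow_le_rpow (ENNReal.ofReal_le_ofReal h) hlp') _

theorem CommutatorBounded.congr {normX normY : (RSpace n → ℝ) → ℝ≥0∞} {b' : RSpace n → ℝ}
    (hb : b =ᵐ[volume] b') (h : CommutatorBounded α Ω b normX normY) :
    CommutatorBounded α Ω b' normX normY := by
  obtain ⟨C, h⟩ := h
  refine ⟨C, fun f hf hfin => ?_⟩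
  obtain ⟨g, hg, h'⟩ := h f hf hfin
  exact ⟨g, hg.congr EventuallyEq.rfl hb EventuallyEq.rfl, h'⟩

theorem MemLip.congr {b' : RSpace n → ℝ} (hb : b =ᵐ[volume] b') (h : MemLip β b) :
    MemLip β b' := by
  obtain ⟨g, hg, hC⟩ := h
  exact ⟨g, hb.symm.trans hg, hC⟩

/-- One-sided oscillation bound for the symbol of a bounded commutator. -/
theorem exists_setLIntegral_oscillation_le (hn : 0 < n) (hαn : α < n) (hp : 1 < p) (hq : 1 < q)
    (hlam_lower : -(n : ℝ) / p ≤ lam) (hlam_neg : lam < 0)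
    (h : CommutatorBounded α Ω b (morreyNorm p lam) (morreyNorm q (α + β + lam)))
    {u₀ : RSpace n} {δ c s : ℝ} (hu₀ : ‖u₀‖ = 1) (hδ : 0 < δ) (hc : 0 < c) (hs : |s| = 1)
    (hcone : ∀ᵐ z : RSpace n, z ≠ 0 → ‖‖z‖⁻¹ • z - u₀‖ < δ → c ≤ s * Ω z) :
    ∃ D : ℝ≥0∞, D ≠ ∞ ∧ ∀ (x₀ : RSpace n) (r : ℝ), 0 < r → ∀ (τ m : ℝ), |τ| = 1 →
      ∀ E : Set (RSpace n), MeasurableSet E →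
      E ⊆ Metric.closedBall (x₀ - ((3 + 4 / δ) * r) • u₀) r →
      volume (Metric.closedBall (x₀ - ((3 + 4 / δ) * r) • u₀) r) ≤ 2 * volume E →
      (∀ y ∈ E, τ * (b y - m) ≤ 0) →
      ∫⁻ x in Metric.closedBall x₀ r, ENNReal.ofReal (τ * (b x - m)) ≤
        D * ENNReal.ofReal r ^ (n + β) := by
  obtain ⟨A, h⟩ := h
  set v := volume.real (Metric.closedBall (0 : RSpace n) 1)
  have hv : 0 < v := ENNReal.toReal_pos (volume_closedBall_ne_zero _ one_pos)
    (volume_closedBall_ne_top _ _)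
  -- κ r^α is the pointwise lower bound per unit of oscillation: kernel size of order r^(α - n)
  -- times |E| ≥ r^n v / 2.
  set κ := c * (5 + 4 / δ) ^ (α - n) * (v / 2) with hκ
  have hκ0 : 0 < κ := by positivity
  refine ⟨(ENNReal.ofReal κ)⁻¹ * (A * 2 ^ (n + (α + β))), ?_,
    fun x₀ r hr τ m hτ E hE hEP hvol hEb => ?_⟩
  · have : (ENNReal.ofReal κ)⁻¹ ≠ ∞ := by simpa using hκ0
    finiteness [two_rpow_ne_top (n + (α + β))]
  have hEfin : volume E ≠ ∞ :=
    ((measure_mono hEP).trans_lt (volume_closedBall_ne_top _ _).lt_top).ne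
  have hvolE : r ^ n * (v / 2) ≤ volume.real E := by
    have h1 := ENNReal.toReal_mono (by finiteness) hvol
    have h2 := Measure.addHaar_closedBall_mul (volume : Measure (RSpace n))
      (x₀ - ((3 + 4 / δ) * r) • u₀) hr.le (zero_le_one' ℝ)
    rw [mul_one, finrank_euclideanSpace_fin] at h2
    rw [h2, ENNReal.toReal_mul, ENNReal.toReal_mul, ENNReal.toReal_ofReal (by positivity)] at h1
    have h3 : r ^ n * v ≤ 2 * volume.real E := by simpa [v, measureReal_def] using h1
    linarith
  set R := ENNReal.ofReal r with hR
  have hR0 : R ≠ 0 := by simpa [hR] using hr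
  have hRt : R ≠ ∞ := ENNReal.ofReal_ne_top
  have hfm : AEStronglyMeasurable (E.indicator (1 : RSpace n → ℝ)) :=
    (measurable_one.indicator hE).aestronglyMeasurable
  have hf := emorreyNorm_indicator_le hn hp hlam_lower hlam_neg hE hr hEP
  rw [← morreyNorm_eq] at hf
  have h2R0 : ENNReal.ofReal (2 * r) ≠ 0 := by simpa using hr
  have h2Rt : ENNReal.ofReal (2 * r) ≠ ∞ := ENNReal.ofReal_ne_top
  obtain ⟨g, hg, hgm, hgn⟩ := h _ hfm (hf.trans_lt
    (ENNReal.rpow_ne_top_of_ne_zero h2R0 h2Rt).lt_top)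
  have hpt := ae_le_abs_commutator_indicator hαn hu₀ hδ hc hs hr hτ hcone hE hEP hEb hg
  have hball : MeasurableSet (Metric.closedBall x₀ r) := Metric.isClosed_closedBall.measurableSet
  have hRα0 : R ^ α ≠ 0 := by simp [ENNReal.rpow_eq_zero_iff, hR0, hRt]
  have hRαt : R ^ α ≠ ∞ := ENNReal.rpow_ne_top_of_ne_zero hR0 hRt
  have hκE0 : ENNReal.ofReal κ ≠ 0 := by simpa using hκ0
  -- Averaging g over the ball costs r^(n + α + β + λ) and the test function has norm at most
  -- (2r)^(-λ), so λ cancels. Dividing by κ r^α leaves r^(n + β).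
  have hmain : ENNReal.ofReal κ * R ^ α *
      ∫⁻ x in Metric.closedBall x₀ r, ENNReal.ofReal (τ * (b x - m)) ≤
      A * 2 ^ (n + (α + β)) * R ^ (n + (α + β)) := by
    calc _ = ∫⁻ x in Metric.closedBall x₀ r, ENNReal.ofReal κ * R ^ α *
          ENNReal.ofReal (τ * (b x - m)) := (lintegral_const_mul' _ _ (by finiteness)).symm
      _ ≤ ∫⁻ x in Metric.closedBall x₀ r, ‖g x‖ₑ := by
          refine lintegral_mono_ae ?_
          rw [ae_restrict_iff' hball]
          filter_upwards [hpt] with x hx hxB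
          rcases le_or_gt (τ * (b x - m)) 0 with h0 | h0
          · simp [ENNReal.ofReal_of_nonpos h0]
          rw [hR, ENNReal.ofReal_rpow_of_pos hr, ← ENNReal.ofReal_mul hκ0.le,
            ← ENNReal.ofReal_mul (by positivity), Real.enorm_eq_ofReal_abs]
          refine ENNReal.ofReal_le_ofReal (le_trans ?_ (hx hxB))
          refine mul_le_mul_of_nonneg_right ?_ h0.le
          calc κ * r ^ α = c * ((5 + 4 / δ) * r) ^ (α - n) * (r ^ n * (v / 2)) := by
                rw [hκ, Real.mul_rpow (by positivity) hr.le, Real.rpow_sub hr, Real.rpow_natCast]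
                field_simp
            _ ≤ _ := mul_le_mul_of_nonneg_left hvolE (by positivity)
      _ ≤ ENNReal.ofReal (2 * r) ^ (n + (α + β + lam)) *
            emorreyNorm q (α + β + lam) (fun x => ‖g x‖ₑ) :=
          setLIntegral_closedBall_le hn hq hr hgm.enorm x₀
      _ ≤ ENNReal.ofReal (2 * r) ^ (n + (α + β + lam)) *
            (A * ENNReal.ofReal (2 * r) ^ (-lam)) :=
          mul_le_mul_right (hgn.trans (mul_le_mul_right hf _)) _
      _ = A * (ENNReal.ofReal (2 * r) ^ (n + (α + β + lam)) *
            ENNReal.ofReal (2 * r) ^ (-lam)) := by ring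
      _ = _ := by
          rw [← ENNReal.rpow_add _ _ h2R0 h2Rt, ENNReal.ofReal_mul (by norm_num),
            ENNReal.mul_rpow_of_ne_top (by simp) hRt, ENNReal.ofReal_ofNat, ← mul_assoc]
          ring_nf
  rw [ENNReal.mul_le_iff_le_inv (mul_ne_zero hκE0 hRα0) (by finiteness)] at hmain
  refine hmain.trans_eq ?_
  have e : R ^ ((n : ℝ) + β) = R ^ (-α) * R ^ (n + (α + β)) := by
    rw [← ENNReal.rpow_add _ _ hR0 hRt]; ring_nf
  rw [ENNReal.mul_inv (Or.inl hκE0) (Or.inr hRα0), ← ENNReal.rpow_neg, e]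
  ring

/-- Boundedness of the commutator on Morrey spaces forces the symbol to be Lipschitz. -/
theorem MemLip.of_commutatorBounded_morrey (hn : 0 < n) (hβ0 : 0 < β) (hβ1 : β < 1) (hαn : α < n)
    (hp : 1 < p) (hq : 1 < q) (hlam_lower : -(n : ℝ) / p ≤ lam) (hlam_neg : lam < 0)
    (hΩ_hom : HomogeneousDegZero Ω) (hΩ_ne : ¬ onSphere Ω =ᵐ[surfaceMeasure n] 0)
    (hΩ_local : LocallyOneSigned Ω ∨ Continuous (onSphere Ω)) (hb : LocallyIntegrable b)
    (h : CommutatorBounded α Ω b (morreyNorm p lam) (morreyNorm q (α + β + lam))) :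
    MemLip β b := by
  have hbm := hb.aestronglyMeasurable
  set b' := hbm.mk b
  have hbb' : b =ᵐ[volume] b' := hbm.ae_eq_mk
  have hm : Measurable b' := hbm.stronglyMeasurable_mk.measurable
  refine MemLip.congr hbb'.symm ?_
  obtain ⟨u₀, δ, c, s, hu₀, hδ, hc, hs, hcone⟩ := exists_cone hn hΩ_hom hΩ_ne hΩ_local
  obtain ⟨D, hD, hosc⟩ := exists_setLIntegral_oscillation_le hn hαn hp hq hlam_lower hlam_neg
    (h.congr hbb') hu₀ hδ hc hs hcone
  refine memLip_of_campanato hn hβ0 hβ1 (hb.congr hbb') (D := 2 * D) (by finiteness)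
    fun x₀ r hr => ?_
  set P := Metric.closedBall (x₀ - ((3 + 4 / δ) * r) • u₀) r with hP
  have hPm : MeasurableSet P := Metric.isClosed_closedBall.measurableSet
  have : IsFiniteMeasure (volume.restrict P) :=
    ⟨by simpa using (volume_closedBall_ne_top (x₀ - ((3 + 4 / δ) * r) • u₀) r).lt_top⟩
  obtain ⟨m, h1, h2⟩ := exists_median (volume.restrict P) hm
  have hle : MeasurableSet {x | b' x ≤ m} := measurableSet_le hm measurable_const
  have hge : MeasurableSet {x | m ≤ b' x} := measurableSet_le measurable_const hm
  rw [Measure.restrict_apply_univ, Measure.restrict_apply hle] at h1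
  rw [Measure.restrict_apply_univ, Measure.restrict_apply hge] at h2
  -- The lower half of P tests the positive part of b' - m on the ball, and the upper half tests the
  -- negative part, with the same m.
  have hup := hosc x₀ r hr 1 m (by simp) _ (hle.inter hPm) Set.inter_subset_right h1
    fun y hy => by have : b' y ≤ m := hy.1; linarith
  have hlow := hosc x₀ r hr (-1) m (by simp) _ (hge.inter hPm) Set.inter_subset_right h2
    fun y hy => by have : m ≤ b' y := hy.1; linarith
  refine ⟨m, ?_⟩
  calc ∫⁻ y in Metric.closedBall x₀ r, ‖b' y - m‖ₑ
      ≤ ∫⁻ y in Metric.closedBall x₀ r,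
          (ENNReal.ofReal (1 * (b' y - m)) + ENNReal.ofReal (-1 * (b' y - m))) := by
        refine lintegral_mono fun y => ?_
        rw [Real.enorm_eq_ofReal_abs]
        rcases abs_cases (b' y - m) with h | h
        · rw [h.1, one_mul]; exact le_self_add
        · rw [h.1, neg_one_mul]; exact le_add_self
    _ ≤ D * ENNReal.ofReal r ^ (n + β) + D * ENNReal.ofReal r ^ (n + β) := by
        rw [lintegral_add_left (by fun_prop)]
        exact add_le_add hup hlow
    _ = _ := by ring

end Necessity

/-! ### The equivalence -/

theorem corollary4p19 (n : ℕ) (α β p q lam ν : ℝ)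
    (hβ0 : 0 < β) (hβ1 : β < 1) (hα0 : 0 ≤ α) (hαn : α < n) (hαβ : α + β < n)
    (hp : 1 < p) (hq : 1 < q) (hpq : 1 / q = 1 / p - (α + β) / n)
    (hlam : α + β + lam < 0) (hlam_lower : -(n : ℝ) / p ≤ lam) (hlam_neg : lam < 0)
    (hν : ν = α + β + lam)
    (Ω : RSpace n → ℝ) (hΩ_hom : HomogeneousDegZero Ω)
    (hΩ_bdd : MemLp (onSphere Ω) ∞ (surfaceMeasure n))
    (hΩ_ne : ¬ onSphere Ω =ᵐ[surfaceMeasure n] 0)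
    (hΩ_mean : α = 0 → ∫ u, onSphere Ω u ∂(surfaceMeasure n) = 0)
    (hΩ_local : LocallyOneSigned Ω ∨ Continuous (onSphere Ω))
    (b : RSpace n → ℝ) (hb : LocallyIntegrable b) :
    List.TFAE
      [MemLip β b,
       CommutatorBounded α Ω b (lebesgueNorm p) (lebesgueNorm q),
       CommutatorBounded α Ω b (morreyNorm p lam) (morreyNorm q ν)] := by
  have hn : 0 < n := by
    have : (0 : ℝ) < n := hα0.trans_lt hαn
    exact_mod_cast this
  have hn' : (0 : ℝ) < n := by exact_mod_cast hn
  have hp0 : 0 < p := by linarith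
  have hq0 : 0 < q := by linarith
  subst hν
  -- The target Morrey exponent for λ = -n/p is exactly the one for which the Morrey norm is the L^q
  -- norm.
  have hν : α + β + -(n : ℝ) / p = -(n : ℝ) / q := by
    have h1 : (n : ℝ) * (1 / q) = n * (1 / p) - (α + β) := by rw [hpq]; field_simp
    rw [show -(n : ℝ) / q = -(n * (1 / q)) by ring, h1]; ring
  have hneg : ∀ s : ℝ, 0 < s → -(n : ℝ) / s < 0 := fun s hs =>
    div_neg_of_neg_of_pos (by linarith) hs
  have hXp : morreyNorm (n := n) p (-(n : ℝ) / p) = lebesgueNorm p :=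
    funext fun f => morreyNorm_neg_div hn hp0 f
  have hYq : morreyNorm (n := n) q (α + β + -(n : ℝ) / p) = lebesgueNorm q := by
    rw [hν]; exact funext fun f => morreyNorm_neg_div hn hq0 f
  tfae_have 1 → 3 := fun h =>
    h.commutatorBounded_morrey hn hβ0 hα0 hαβ hp hq hpq hlam hΩ_hom hΩ_bdd
  tfae_have 3 → 1 := fun h =>
    .of_commutatorBounded_morrey hn hβ0 hβ1 hαn hp hq hlam_lower hlam_neg hΩ_hom hΩ_ne hΩ_local hb h
  tfae_have 1 → 2 := fun h => by
    rw [← hXp, ← hYq]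
    exact h.commutatorBounded_morrey hn hβ0 hα0 hαβ hp hq hpq (by rw [hν]; exact hneg q hq0)
      hΩ_hom hΩ_bdd
  tfae_have 2 → 1 := fun h => by
    rw [← hXp, ← hYq] at h
    exact .of_commutatorBounded_morrey hn hβ0 hβ1 hαn hp hq le_rfl (hneg p hp0) hΩ_hom hΩ_ne
      hΩ_local hb h
  tfae_finish
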